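/- Let $N,m$ be natural numbers and $f_1,\dots,f_N:\mathbb R^m\to\mathbb R$ twice continuously differentiable functions such that, for some constants $0<\mu\le L<\infty$, $\mu I\preceq\nabla^2 f_i(x)\preceq L I$ for all $i$ and all $x\in\mathbb R^m$. Let $\mathcal G(k)$, $k=0,1,\dots$, be random undirected simple graphs on the node set $\{1,\dots,N\}$, let $\Omega_i(k)$ be the set of neighbors of node $i$ in $\mathcal G(k)$, and let $\mathcal L(k)$ be the Laplacian matrix (degree matrix minus adjacency matrix) of $\mathcal G(k)$. Assume that the random matrices $\mathcal L(0),\mathcal L(1),\dots$ are independent and identically distributed, and that the graph on $\{1,\dots,N\}$ in which distinct nodes $i,j$ are joined exactly when $\mathbb E[\mathcal L_{ij}(0)]<0$ is connected. For arbitrary deterministic initial points $x_i(0)\in\mathbb R^m$, consider the distributed stochastic gradient method $$x_i(k+1)=x_i(k)-\beta_k\sum_{j\in\Omega_i(k)}\bigl(x_i(k)-x_j(k)\bigr)-\alpha_k\bigl(\nabla f_i(x_i(k))+v_i(k)\bigr),\qquad i=1,\dots,N,\ k=0,1,\dots,$$ where $v_i(k)$ are $\mathbb R^m$-valued random vectors.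 Let $\mathcal F_k$ be the $\sigma$-algebra generated by $\mathcal L(s)$ and $v_i(t)$ for $i=1,\dots,N$ and $0\le s,t\le k-1$, and assume that, for some constants $c_v,c_v'\ge 0$ and all $i$ and $k$, almost surely $$\mathbb E[v_i(k)\mid\mathcal F_k]=0,\qquad \mathbb E[\|v_i(k)\|^2\mid\mathcal F_k]\le c_v\|x_i(k)\|^2+c_v'.$$ Let $\alpha_k=\alpha_0/(k+1)$ with $\alpha_0>2N/\mu$ and $\beta_k=\beta_0/(k+1)^\nu$ with $\beta_0>0$ and $\nu\in[0,1/2]$. If $\nu=0$ (constant weights), assume in addition that $\beta_0$ is sufficiently small, in the sense that, for all $k$ and $i$, $\beta_0\,|\Omega_i(k)|<1$ almost surely (for instance, $\beta_0=1/(1+\theta)$ with $\theta$ the maximal degree of the nodes). Then the problem of minimizing $\sum_{i=1}^N f_i(x)$ over $x\in\mathbb R^m$ has a unique solution $x^\star$, and for every node $i$ the expectations $\mathbb E\bigl[\|x_i(k)-x^\star\|^2\bigr]$ are finite for all $k$ and satisfy $$\mathbb E\bigl[\|x_i(k)-x^\star\|^2\bigr]=O(1/k)\qquad (k\to\infty).$$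 -/

import Mathlib

open Filter MeasureTheory ProbabilityTheory Asymptotics

noncomputable section

namespace DistSGD

/-- Euclidean space `ℝ^m`. -/
abbrev Vec (m : ℕ) : Type := EuclideanSpace ℝ (Fin m)

/-- The Hessian of `f` at `x`, as a linear operator: the derivative of the gradient. -/
def hessian {m : ℕ} (f : Vec m → ℝ) (x : Vec m) : Vec m →L[ℝ] Vec m :=
  fderiv ℝ (gradient f) x

/-- The local costs are twice continuously differentiable, and `μ I ⪯ ∇² f_i(x) ⪯ L I`
everywhere, with `0 < μ ≤ L` (`≤` between operators is the Loewner order). -/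
structure CostAssumption {N m : ℕ} (f : Fin N → Vec m → ℝ) (μ L : ℝ) : Prop where
  mu_pos : 0 < μ
  mu_le : μ ≤ L
  contDiff : ∀ i, ContDiff ℝ 2 (f i)
  lower : ∀ i x, μ • ContinuousLinearMap.id ℝ (Vec m) ≤ hessian (f i) x
  upper : ∀ i x, hessian (f i) x ≤ L • ContinuousLinearMap.id ℝ (Vec m)

/-- `x` solves the problem of minimizing `∑ i, f i` over `ℝ^m`. -/
def IsSolution {N m : ℕ} (f : Fin N → Vec m → ℝ) (x : Vec m) : Prop :=
  ∀ y, ∑ i, f i x ≤ ∑ i, f i y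

open scoped Classical in
/-- The Laplacian matrix (degree matrix minus adjacency matrix) of a graph on `N` nodes. -/
def laplacian {N : ℕ} (G : SimpleGraph (Fin N)) : Matrix (Fin N) (Fin N) ℝ :=
  G.lapMatrix ℝ

open scoped Classical in
/-- The set of neighbors of node `i` in `G`. -/
def neighbors {N : ℕ} (G : SimpleGraph (Fin N)) (i : Fin N) : Finset (Fin N) :=
  G.neighborFinset i

/-- The graph induced by a (mean) Laplacian matrix `A`: distinct nodes `i`, `j` are joined when
the off-diagonal entry is nonzero, that is, negative; symmetrized so that it is a graph for
every matrix `A`. -/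
def inducedGraph {N : ℕ} (A : Matrix (Fin N) (Fin N) ℝ) : SimpleGraph (Fin N) :=
  SimpleGraph.fromRel fun i j => A i j < 0

/-- Real matrices carry the product (Borel) σ-algebra of their entries. -/
instance instMeasurableSpaceMatrix {N : ℕ} : MeasurableSpace (Matrix (Fin N) (Fin N) ℝ) :=
  inferInstanceAs (MeasurableSpace (Fin N → Fin N → ℝ))

/-- The entrywise expectation of the Laplacian of a random graph. -/
def meanLaplacian {Ω : Type*} [MeasurableSpace Ω] {N : ℕ} (P : Measure Ω)
    (G : Ω → SimpleGraph (Fin N)) : Matrix (Fin N) (Fin N) ℝ :=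
  Matrix.of fun i j => ∫ ω, laplacian (G ω) i j ∂P

/-- The Laplacians of the random graphs `G 0, G 1, …` are i.i.d. random matrices, and the graph
induced by their common mean is connected. -/
structure NetworkAssumption {Ω : Type*} [MeasurableSpace Ω] {N : ℕ} (P : Measure Ω)
    (G : ℕ → Ω → SimpleGraph (Fin N)) : Prop where
  measurable : ∀ k, Measurable fun ω => laplacian (G k ω)
  indep : iIndepFun (fun k ω => laplacian (G k ω)) P
  identDistrib : ∀ k, IdentDistrib (fun ω => laplacian (G k ω)) (fun ω => laplacian (G 0 ω)) P P
  connected : (inducedGraph (meanLaplacian P (G 0))).Connected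

/-- The step sizes `α_k = α₀ / (k + 1)`. -/
def stepAlpha (α₀ : ℝ) (k : ℕ) : ℝ := α₀ / ((k : ℝ) + 1)

/-- The consensus weights `β_k = β₀ / (k + 1) ^ ν`. -/
def stepBeta (β₀ ν : ℝ) (k : ℕ) : ℝ := β₀ / ((k : ℝ) + 1) ^ ν

/-- The iterates of the distributed stochastic gradient method:
`iterate f G v α β x₀ k ω i` is the estimate of node `i` at time `k`. -/
def iterate {Ω : Type*} {N m : ℕ} (f : Fin N → Vec m → ℝ) (G : ℕ → Ω → SimpleGraph (Fin N))
    (v : Fin N → ℕ → Ω → Vec m) (α β : ℕ → ℝ) (x₀ : Fin N → Vec m) :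
    ℕ → Ω → Fin N → Vec m
  | 0, _, i => x₀ i
  | k + 1, ω, i =>
    iterate f G v α β x₀ k ω i
      - β k • ∑ j ∈ neighbors (G k ω) i,
          (iterate f G v α β x₀ k ω i - iterate f G v α β x₀ k ω j)
      - α k • (gradient (f i) (iterate f G v α β x₀ k ω i) + v i k ω)

/-- The history `ℱ_k`: the σ-algebra generated by the Laplacians and the noises of all nodes at
the times `0, …, k - 1`. -/
@[reducible] def history {Ω : Type*} {N m : ℕ} (G : ℕ → Ω → SimpleGraph (Fin N))
    (v : Fin N → ℕ → Ω → Vec m) (k : ℕ) : MeasurableSpace Ω :=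
  (⨆ s : Fin k, MeasurableSpace.comap (fun ω => laplacian (G s ω)) inferInstance) ⊔
    ⨆ i : Fin N, ⨆ t : Fin k, MeasurableSpace.comap (v i t) inferInstance

/-- The gradient noise `v` is a martingale difference with respect to the history, with
conditional second moment of `v_i(k)` at most `c ‖x_i(k)‖² + c'`, where `x k ω i` is `x_i(k)`.
The field `memLp` (finite second moments) makes Mathlib's conditional expectations the genuine
ones; for the iterates of the method started at deterministic points it is a consequence, by
induction on `k`, of the conditional second moment bound. -/
structure NoiseAssumption {Ω : Type*} [MeasurableSpace Ω] {N m : ℕ} (P : Measure Ω)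
    (G : ℕ → Ω → SimpleGraph (Fin N))
    (v : Fin N → ℕ → Ω → Vec m) (x : ℕ → Ω → Fin N → Vec m) (c c' : ℝ) : Prop where
  c_nonneg : 0 ≤ c
  c'_nonneg : 0 ≤ c'
  measurable : ∀ i k, Measurable (v i k)
  memLp : ∀ i k, MemLp (v i k) 2 P
  condMean : ∀ i k, P[v i k | history G v k] =ᵐ[P] 0
  condSq : ∀ i k, P[fun ω => ‖v i k ω‖ ^ 2 | history G v k]
    ≤ᵐ[P] fun ω => c * ‖x k ω i‖ ^ 2 + c'

end DistSGD

end

/-!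
The noise may be correlated with the current and with future graphs: `ℱ_k` only contains the past
Laplacians and noises, and a noise vector at time `t` may anticipate the graphs after `t`. Hence
`x_i(k)` need not be independent of the Laplacian at time `k`, and the usual argument, averaging
the contraction of the disagreement over the graph conditionally on the iterate, does not apply to
`x_i(k)` itself. It does apply to the noiseless run `y_i(k)` of the method on the same graphs
(`noiseless`), which is a function of the graphs before time `k`. The proof therefore bounds
separately the error of `y` and the difference `d = x - y`.

Common to both is one step estimate in a Hilbert space, `norm_sq_step_le`: for a step
`d ↦ d - ℓ - α (h + w)` with a dissipative part `ℓ` satisfying `‖ℓ‖² ≤ 2 ρ ⟪d, ℓ⟫`, `ρ < 1`, and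
a strongly monotone Lipschitz part `h`, the squared norm becomes at most
`(1 - 2 α μ + O(α²)) ‖d‖² - 2 α ⟪d, w⟫ + O(α²) ‖w‖²`. The correlation between `w` and `ℓ` costs
nothing to first order, because the dissipation absorbs it. The diffusion `ℓ = β_k 𝓛(k) d` is
dissipative in this sense as soon as `β_k` times the maximal degree is at most `ρ`, which holds for
all large `k` (`exists_eventually_stableWeights`).

* Difference `d`: here `w = v(k)` is orthogonal to `d` in `L²`, since `d` is known to `ℱ_k`, and
  the step estimate gives `E‖d‖² = O(1/k)` (`eventually_noise_effect_le`).
* Boundedness of `y`: with `w = ∇f_i(x⋆)` the step estimate bounds `E‖y - x⋆‖²`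
  (`eventually_noiseless_bounded`).
* Disagreement of `y`: by independence the energy dissipated at time `k` has the mean of the energy
  of the mean graph, which is connected, so the mean squared disagreement is contracted by
  a factor `1 - c β_k` against perturbations of size `α_k`. This gives the
  order `(α_k / β_k)²`, which is `O(1/k)` because `ν ≤ 1/2` (`eventually_disagreement_le`).
* Average of `y`: it follows the gradient method for the average cost with an error controlled by
  the disagreement, and `α₀ μ > 2` gives the rate `O(1/k)` (`eventually_noiseless_mean_le`).
-/

noncomputable section

namespace DistSGD

open scoped RealInnerProductSpace

/-! ### Gradients of the local costs and the minimizer -/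

/-- A symmetric operator between `0` and `L` in the Loewner order has norm at most `L`. -/
lemma norm_le_of_nonneg_of_le {E : Type*} [NormedAddCommGroup E] [InnerProductSpace ℝ E]
    {T : E →L[ℝ] E} {L : ℝ} (h0 : T.IsPositive)
    (hL : T ≤ L • ContinuousLinearMap.id ℝ E) (hL0 : 0 ≤ L) : ‖T‖ ≤ L := by
  refine T.opNorm_le_bound hL0 fun x => ?_
  have hup : ∀ z, ⟪T z, z⟫ ≤ L * ‖z‖ ^ 2 := fun z => by
    have := ContinuousLinearMap.IsPositive.inner_nonneg_left
      ((ContinuousLinearMap.le_def _ _).1 hL) z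
    simpa [inner_sub_left, inner_smul_left] using this
  have hlo : ∀ z, 0 ≤ ⟪T z, z⟫ := fun z => h0.inner_nonneg_left z
  have hsymm : ∀ z w, ⟪T z, w⟫ = ⟪T w, z⟫ := fun z w => by
    rw [h0.inner_left_eq_inner_right, real_inner_comm]
  rcases eq_or_lt_of_le (norm_nonneg (T x)) with hTx | hTx
  · rw [← hTx]; positivity
  -- polarization at the vectors `‖T x‖ • x` and `‖x‖ • T x`, which have equal norms
  have h1 := hup (‖T x‖ • x + ‖x‖ • T x)
  have h2 := hlo (‖T x‖ • x - ‖x‖ • T x)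
  have h3 : ‖‖T x‖ • x + ‖x‖ • T x‖ ^ 2 ≤ (2 * (‖T x‖ * ‖x‖)) ^ 2 := by
    gcongr
    calc ‖‖T x‖ • x + ‖x‖ • T x‖ ≤ ‖‖T x‖ • x‖ + ‖‖x‖ • T x‖ := norm_add_le _ _
      _ = 2 * (‖T x‖ * ‖x‖) := by simp [norm_smul]; ring
  simp only [map_add, map_sub, map_smul, inner_add_left, inner_add_right, inner_sub_left,
    inner_sub_right, real_inner_smul_left, real_inner_smul_right] at h1 h2
  rw [hsymm (T x) x, real_inner_self_eq_norm_sq] at h1 h2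
  have h4 : 4 * (‖T x‖ * ‖x‖ * ‖T x‖ ^ 2) ≤ L * (2 * (‖T x‖ * ‖x‖)) ^ 2 := by
    have := mul_le_mul_of_nonneg_left h3 hL0
    nlinarith
  rcases eq_or_lt_of_le (norm_nonneg x) with hx | hx
  · have : x = 0 := norm_eq_zero.1 hx.symm
    simp [this]
  · have hp : 0 < ‖T x‖ ^ 2 * ‖x‖ := by positivity
    nlinarith

section Costs

variable {N m : ℕ} {f : Fin N → Vec m → ℝ} {μ L : ℝ}

lemma CostAssumption.hasGradientAt (hf : CostAssumption f μ L) (i : Fin N) (x : Vec m) :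
    HasGradientAt (f i) (gradient (f i) x) x :=
  (((hf.contDiff i).differentiable (by norm_num)) x).hasGradientAt

lemma CostAssumption.differentiable_gradient (hf : CostAssumption f μ L) (i : Fin N) :
    Differentiable ℝ (gradient (f i)) := by
  have h : Differentiable ℝ (fderiv ℝ (f i)) :=
    ((hf.contDiff i).fderiv_right (m := 1) (by norm_num)).differentiable (by norm_num)
  exact ((InnerProductSpace.toDual ℝ (Vec m)).symm.toContinuousLinearEquiv.differentiable).comp h

lemma CostAssumption.norm_gradient_sub_le (hf : CostAssumption f μ L) (i : Fin N) (x y : Vec m) :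
    ‖gradient (f i) x - gradient (f i) y‖ ≤ L * ‖x - y‖ := by
  have hL : 0 ≤ L := hf.mu_pos.le.trans hf.mu_le
  refine convex_univ.norm_image_sub_le_of_norm_fderiv_le
    (fun z _ => hf.differentiable_gradient i z) (fun z _ => ?_) (Set.mem_univ _) (Set.mem_univ _)
  refine norm_le_of_nonneg_of_le ?_ (hf.upper i z) hL
  refine (ContinuousLinearMap.nonneg_iff_isPositive _).1 (le_trans ?_ (hf.lower i z))
  exact (ContinuousLinearMap.nonneg_iff_isPositive _).2
    (ContinuousLinearMap.isPositive_id.smul_of_nonneg hf.mu_pos.le)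

/-- Strong monotonicity of the gradients, from the lower bound on the Hessians. -/
lemma CostAssumption.le_inner_gradient_sub (hf : CostAssumption f μ L) (i : Fin N)
    (x y : Vec m) :
    μ * ‖x - y‖ ^ 2 ≤ ⟪x - y, gradient (f i) x - gradient (f i) y⟫ := by
  have hd : ∀ t : ℝ, HasDerivAt (fun t : ℝ => ⟪x - y, gradient (f i) (y + t • (x - y))⟫)
      ⟪x - y, hessian (f i) (y + t • (x - y)) (x - y)⟫ t := fun t => by
    have h1 : HasDerivAt (fun t : ℝ => y + t • (x - y)) (x - y) t := by
      simpa using ((hasDerivAt_id t).smul_const (x - y)).const_add y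
    have h2 := (hf.differentiable_gradient i (y + t • (x - y))).hasFDerivAt.comp_hasDerivAt t h1
    refine ((hasDerivAt_const t (x - y)).inner ℝ h2).congr_deriv ?_
    rw [inner_zero_left, add_zero, hessian]
  obtain ⟨t, -, ht⟩ := exists_hasDerivAt_eq_slope _ _ (zero_lt_one (α := ℝ))
    (fun t _ => (hd t).continuousAt.continuousWithinAt) (fun t _ => hd t)
  have h := ((ContinuousLinearMap.le_def _ _).1
    (hf.lower i (y + t • (x - y)))).inner_nonneg_right (x - y)
  simp only [one_smul, zero_smul, add_zero, sub_zero, div_one, add_sub_cancel] at ht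
  rw [inner_sub_right, ← ht]
  rw [FunLike.coe_sub, Pi.sub_apply, FunLike.coe_smul, Pi.smul_apply,
    ContinuousLinearMap.id_apply, inner_sub_right, real_inner_smul_right,
    real_inner_self_eq_norm_sq] at h
  linarith

lemma CostAssumption.norm_gradient_le (hf : CostAssumption f μ L) (i : Fin N) (x : Vec m) :
    ‖gradient (f i) x‖ ≤ ‖gradient (f i) 0‖ + L * ‖x‖ := by
  have h := hf.norm_gradient_sub_le i x 0
  rw [sub_zero] at h
  have := norm_add_le (gradient (f i) 0) (gradient (f i) x - gradient (f i) 0)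
  rw [add_sub_cancel] at this
  linarith

/-- A Lipschitz and strongly monotone map of a Hilbert space vanishes somewhere: for a small step
`t`, the map `x ↦ x - t g(x)` is a contraction. -/
lemma exists_eq_zero_of_stronglyMonotone {E : Type*} [NormedAddCommGroup E]
    [InnerProductSpace ℝ E] [CompleteSpace E] {g : E → E} {μ L : ℝ} (hμ : 0 < μ) (hμL : μ ≤ L)
    (hmono : ∀ x y, μ * ‖x - y‖ ^ 2 ≤ ⟪x - y, g x - g y⟫)
    (hLip : ∀ x y, ‖g x - g y‖ ≤ L * ‖x - y‖) : ∃ x, g x = 0 := by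
  have hL : 0 < L := hμ.trans_le hμL
  set t : ℝ := μ / L ^ 2 with ht
  have ht0 : 0 < t := by positivity
  set q : ℝ := 1 - t * μ with hq
  have htμ : t * μ ≤ 1 := by
    rw [ht, div_mul_eq_mul_div, div_le_one (by positivity)]
    nlinarith
  have hq0 : 0 ≤ q := by linarith
  have hq1 : q < 1 := by nlinarith
  have hcontr : ContractingWith (Real.toNNReal (Real.sqrt q)) (fun x => x - t • g x) := by
    refine ⟨?_, LipschitzWith.of_dist_le_mul fun x y => ?_⟩
    · rw [Real.toNNReal_lt_one, Real.sqrt_lt' one_pos]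
      simpa using hq1
    · rw [Real.coe_toNNReal _ (Real.sqrt_nonneg _), dist_eq_norm, dist_eq_norm]
      refine abs_le_of_sq_le_sq' (a := ‖x - t • g x - (y - t • g y)‖) ?_ (by positivity) |>.2
      rw [mul_pow, Real.sq_sqrt hq0]
      have e : x - t • g x - (y - t • g y) = (x - y) - t • (g x - g y) := by
        rw [smul_sub]; abel
      rw [e, norm_sub_sq_real, real_inner_smul_right, norm_smul, mul_pow, Real.norm_eq_abs,
        sq_abs]
      have h1 : ‖g x - g y‖ ^ 2 ≤ L ^ 2 * ‖x - y‖ ^ 2 := by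
        rw [← mul_pow]; gcongr; exact hLip x y
      have h2 : t ^ 2 * ‖g x - g y‖ ^ 2 ≤ t * μ * ‖x - y‖ ^ 2 := by
        calc t ^ 2 * ‖g x - g y‖ ^ 2 ≤ t ^ 2 * (L ^ 2 * ‖x - y‖ ^ 2) := by gcongr
          _ = t * μ * ‖x - y‖ ^ 2 := by rw [ht]; field_simp
      have h3 := mul_le_mul_of_nonneg_left (hmono x y) ht0.le
      rw [hq]; linarith
  have := hcontr.fixedPoint_isFixedPt
  refine ⟨hcontr.fixedPoint _, ?_⟩
  have h : t • g (hcontr.fixedPoint _) = 0 := by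
    have h' : _ - t • g (hcontr.fixedPoint _) = hcontr.fixedPoint _ := this
    simpa using h'
  exact (smul_eq_zero.1 h).resolve_left ht0.ne'

/-- A function whose gradient is strongly monotone and vanishes at `x` is minimal at `x` only. -/
lemma lt_of_gradient_eq_zero {E : Type*} [NormedAddCommGroup E] [InnerProductSpace ℝ E]
    [CompleteSpace E] {F : E → ℝ} {g : E → E} {μ : ℝ} (hμ : 0 < μ)
    (hF : ∀ x, HasGradientAt F (g x) x)
    (hmono : ∀ x y, μ * ‖x - y‖ ^ 2 ≤ ⟪x - y, g x - g y⟫) {x y : E} (hx : g x = 0)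
    (hxy : y ≠ x) : F x < F y := by
  have hd : ∀ t : ℝ, HasDerivAt (fun t : ℝ => F (x + t • (y - x)))
      ⟪g (x + t • (y - x)), y - x⟫ t := fun t => by
    have h1 : HasDerivAt (fun t : ℝ => x + t • (y - x)) (y - x) t := by
      simpa using ((hasDerivAt_id t).smul_const (y - x)).const_add x
    exact ((hF (x + t • (y - x))).hasFDerivAt.comp_hasDerivAt t h1).congr_deriv (by simp)
  obtain ⟨t, ht0, ht⟩ := exists_hasDerivAt_eq_slope _ _ (zero_lt_one (α := ℝ))
    (fun t _ => (hd t).continuousAt.continuousWithinAt) (fun t _ => hd t)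
  simp only [one_smul, zero_smul, add_zero, sub_zero, div_one, add_sub_cancel] at ht
  have h := hmono (x + t • (y - x)) x
  rw [hx, sub_zero, add_sub_cancel_left, real_inner_smul_left, norm_smul, mul_pow,
    real_inner_comm, ht, Real.norm_eq_abs, sq_abs] at h
  have hpos : 0 < μ * (t ^ 2 * ‖y - x‖ ^ 2) := by
    have := norm_pos_iff.2 (sub_ne_zero.2 hxy)
    have := ht0.1
    positivity
  have := pos_of_mul_pos_right (hpos.trans_le h) ht0.1.le
  linarith

/-- The minimization problem has exactly one solution, and it is the zero of the total gradient. -/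
lemma CostAssumption.exists_unique_solution [NeZero N] (hf : CostAssumption f μ L) :
    ∃ xs : Vec m, IsSolution f xs ∧ (∀ y, IsSolution f y → y = xs) ∧
      ∑ i, gradient (f i) xs = 0 := by
  have hN : (0 : ℝ) < N := by exact_mod_cast Nat.pos_of_neZero N
  have hmono : ∀ x y : Vec m, (N * μ) * ‖x - y‖ ^ 2 ≤
      ⟪x - y, ∑ i, gradient (f i) x - ∑ i, gradient (f i) y⟫ := fun x y => by
    rw [← Finset.sum_sub_distrib, inner_sum]
    calc (N * μ) * ‖x - y‖ ^ 2 = ∑ _i : Fin N, μ * ‖x - y‖ ^ 2 := by simp; ring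
      _ ≤ _ := Finset.sum_le_sum fun i _ => hf.le_inner_gradient_sub i x y
  have hLip : ∀ x y : Vec m, ‖∑ i, gradient (f i) x - ∑ i, gradient (f i) y‖ ≤
      (N * L) * ‖x - y‖ := fun x y => by
    rw [← Finset.sum_sub_distrib]
    calc _ ≤ ∑ i : Fin N, L * ‖x - y‖ :=
          norm_sum_le_of_le _ fun i _ => hf.norm_gradient_sub_le i x y
      _ = _ := by simp; ring
  have hμ : 0 < N * μ := mul_pos hN hf.mu_pos
  obtain ⟨xs, hxs⟩ := exists_eq_zero_of_stronglyMonotone hμ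
    (mul_le_mul_of_nonneg_left hf.mu_le hN.le) hmono hLip
  have hgrad : ∀ x, HasGradientAt (fun x => ∑ i, f i x) (∑ i, gradient (f i) x) x := fun x => by
    rw [hasGradientAt_iff_hasFDerivAt, map_sum]
    exact HasFDerivAt.fun_sum fun i _ => (hf.hasGradientAt i x).hasFDerivAt
  have hlt : ∀ y, y ≠ xs → ∑ i, f i xs < ∑ i, f i y := fun y hy =>
    lt_of_gradient_eq_zero hμ hgrad hmono hxs hy
  refine ⟨xs, fun y => ?_, fun y hy => ?_, hxs⟩
  · rcases eq_or_ne y xs with rfl | h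
    exacts [le_rfl, (hlt y h).le]
  · by_contra h
    exact absurd (hy xs) (not_le.2 (hlt y h))

end Costs

/-! ### Scalar recursions -/

lemma eventually_bounded_of_recursion {a γ : ℕ → ℝ} {B : ℝ}
    (hγ0 : ∀ᶠ k in atTop, 0 ≤ γ k) (hγ1 : ∀ᶠ k in atTop, γ k ≤ 1)
    (ha : ∀ᶠ k in atTop, a (k + 1) ≤ (1 - γ k) * a k + B * γ k) :
    ∃ M, 0 ≤ M ∧ ∀ᶠ k in atTop, a k ≤ M := by
  obtain ⟨K, hK⟩ := eventually_atTop.1 (hγ0.and (hγ1.and ha))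
  refine ⟨max 0 (max (a K) B), le_max_left _ _, eventually_atTop.2 ⟨K, fun k hk => ?_⟩⟩
  induction k, hk using Nat.le_induction with
  | base => exact (le_max_left _ _).trans (le_max_right _ _)
  | succ k hk ih =>
    obtain ⟨h0, h1, h2⟩ := hK k hk
    set M := max 0 (max (a K) B)
    have hB : B ≤ M := (le_max_right _ _).trans (le_max_right _ _)
    nlinarith [mul_le_mul_of_nonneg_left ih (sub_nonneg.2 h1), mul_le_mul_of_nonneg_right hB h0]

/-- Chung's lemma in the form used here: contraction factors `1 - γ_k` with `γ_k ≥ r / (k + 1)`,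
`r > 1`, against perturbations of size `γ_k / (k + 1)` give a decay of order `1 / k`. -/
lemma eventually_le_div_of_recursion {a γ : ℕ → ℝ} {B r : ℝ} (hr : 1 < r)
    (hγ1 : ∀ᶠ k in atTop, γ k ≤ 1) (hγr : ∀ᶠ k : ℕ in atTop, r ≤ γ k * ((k : ℝ) + 1))
    (ha : ∀ᶠ k : ℕ in atTop, a (k + 1) ≤ (1 - γ k) * a k + B * γ k / ((k : ℝ) + 1)) :
    ∃ M, 0 ≤ M ∧ ∀ᶠ k : ℕ in atTop, a k ≤ M / ((k : ℝ) + 1) := by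
  obtain ⟨K, hK⟩ := eventually_atTop.1 (hγ1.and (hγr.and ha))
  set M := max 0 (max (a K * ((K : ℝ) + 1)) (r * B / (r - 1))) with hM
  have hM0 : 0 ≤ M := le_max_left _ _
  have hMK : a K * ((K : ℝ) + 1) ≤ M := (le_max_left _ _).trans (le_max_right _ _)
  have hMB : r * B / (r - 1) ≤ M := (le_max_right _ _).trans (le_max_right _ _)
  rw [div_le_iff₀ (by linarith)] at hMB
  refine ⟨M, hM0, eventually_atTop.2 ⟨K, fun k hk => ?_⟩⟩
  induction k, hk using Nat.le_induction with
  | base => rwa [le_div_iff₀ (by positivity)]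
  | succ k hk ih =>
    obtain ⟨h1, hr', h2⟩ := hK k hk
    have hk : (0 : ℝ) < (k : ℝ) + 1 := by positivity
    have h3 := mul_le_mul_of_nonneg_left ih (sub_nonneg.2 h1)
    have h4 : a (k + 1) * ((k : ℝ) + 1) ≤ M - γ k * (M - B) := by
      have h5 : a (k + 1) ≤ (1 - γ k) * (M / ((k : ℝ) + 1)) + B * γ k / ((k : ℝ) + 1) := by
        linarith
      calc a (k + 1) * ((k : ℝ) + 1)
          ≤ ((1 - γ k) * (M / ((k : ℝ) + 1)) + B * γ k / ((k : ℝ) + 1)) * ((k : ℝ) + 1) := by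
            gcongr
        _ = M - γ k * (M - B) := by field_simp; ring
    have hMB' : 0 ≤ M - B := by
      have : r * B ≤ r * M := by nlinarith
      have := le_of_mul_le_mul_left this (by linarith)
      linarith
    have h6 : M ≤ γ k * ((k : ℝ) + 1) * (M - B) := by
      have := mul_le_mul_of_nonneg_right hr' hMB'
      nlinarith
    push_cast
    rw [le_div_iff₀ (by positivity)]
    -- multiplied by `k + 1`, the claim is `(M - γ (M - B)) (k + 2) ≤ M (k + 1)`
    refine le_of_mul_le_mul_right ?_ hk
    have hγ : 0 ≤ γ k := by
      by_contra hneg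
      nlinarith [mul_neg_of_neg_of_pos (not_le.1 hneg) hk]
    have h7 : 0 ≤ γ k * (M - B) := mul_nonneg hγ hMB'
    have h8 := mul_le_mul_of_nonneg_right h4 (by positivity : (0 : ℝ) ≤ (k : ℝ) + 1 + 1)
    nlinarith

/-! ### Diffusion along a weighted graph -/

/-- The quadratic form of the Laplacian of `a`, without the usual factor `1 / 2`: every
unordered pair is counted twice. -/
def energy {ι : Type*} [Fintype ι] {E : Type*} [NormedAddCommGroup E]
    (a : ι → ι → ℝ) (x : ι → E) : ℝ :=
  ∑ i, ∑ j, a i j * ‖x i - x j‖ ^ 2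

lemma energy_nonneg {ι : Type*} [Fintype ι] {E : Type*} [NormedAddCommGroup E] {a : ι → ι → ℝ}
    (h : ∀ i j, 0 ≤ a i j) (x : ι → E) : 0 ≤ energy a x :=
  Finset.sum_nonneg fun i _ => Finset.sum_nonneg fun j _ => mul_nonneg (h i j) (sq_nonneg _)

section Diffusion

variable {ι : Type*} [Fintype ι] {E : Type*} [NormedAddCommGroup E] [InnerProductSpace ℝ E]

/-- The Laplacian of the weights `a` acting on a family of vectors. -/
def diffusion (a : ι → ι → ℝ) (x : ι → E) (i : ι) : E := ∑ j, a i j • (x i - x j)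

/-- The average of a family of vectors. -/
def mean (x : ι → E) : E := (Fintype.card ι : ℝ)⁻¹ • ∑ i, x i

/-- The total squared deviation of a family of vectors from its average. -/
def disagreement (x : ι → E) : ℝ := ∑ i, ‖x i - mean x‖ ^ 2

/-- Symmetric nonnegative weights `a` with a diffusion step `β` that is at most `ρ` times the
inverse of the largest weighted degree. For `ρ < 1` this is the stability range of the
diffusion `x ↦ x - β • diffusion a x`. -/
structure StableWeights (a : ι → ι → ℝ) (β ρ : ℝ) : Prop where
  symm : ∀ i j, a i j = a j i
  nonneg : ∀ i j, 0 ≤ a i j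
  step_nonneg : 0 ≤ β
  degree_le : ∀ i, β * ∑ j, a i j ≤ ρ

lemma diffusion_sub (a : ι → ι → ℝ) (x y : ι → E) (i : ι) :
    diffusion a (fun j => x j - y j) i = diffusion a x i - diffusion a y i := by
  simp only [diffusion, ← Finset.sum_sub_distrib, ← smul_sub]
  refine Finset.sum_congr rfl fun j _ => ?_
  congr 1; abel

@[simp]
lemma diffusion_const (a : ι → ι → ℝ) (z : E) (i : ι) : diffusion a (fun _ => z) i = 0 := by
  simp [diffusion]

lemma sum_inner_diffusion {a : ι → ι → ℝ} (ha : ∀ i j, a i j = a j i) (x : ι → E) :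
    ∑ i, ⟪x i, diffusion a x i⟫ = energy a x / 2 := by
  have h1 : ∑ i, ⟪x i, diffusion a x i⟫ = ∑ i, ∑ j, a i j * ⟪x i, x i - x j⟫ := by
    simp [diffusion, inner_sum, real_inner_smul_right]
  have h2 : ∑ i, ⟪x i, diffusion a x i⟫ = ∑ i, ∑ j, a i j * ⟪x j, x j - x i⟫ := by
    rw [h1, Finset.sum_comm]
    exact Finset.sum_congr rfl fun i _ => Finset.sum_congr rfl fun j _ => by rw [ha]
  have h3 : energy a x = ∑ i, ∑ j, a i j * ⟪x i, x i - x j⟫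
      + ∑ i, ∑ j, a i j * ⟪x j, x j - x i⟫ := by
    simp only [energy, ← Finset.sum_add_distrib, ← mul_add]
    refine Finset.sum_congr rfl fun i _ => Finset.sum_congr rfl fun j _ => ?_
    rw [← real_inner_self_eq_norm_sq, inner_sub_left, inner_sub_right (x j), inner_sub_right (x i),
      inner_sub_right (x j)]
    ring
  rw [h3, ← h1, ← h2]; ring

lemma sum_diffusion {a : ι → ι → ℝ} (ha : ∀ i j, a i j = a j i) (x : ι → E) :
    ∑ i, diffusion a x i = 0 := by
  have h : ∑ i, diffusion a x i = -∑ i, diffusion a x i := by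
    conv_lhs => simp only [diffusion]
    rw [Finset.sum_comm]
    simp only [diffusion, ← Finset.sum_neg_distrib]
    refine Finset.sum_congr rfl fun i _ => Finset.sum_congr rfl fun j _ => ?_
    rw [ha, ← smul_neg, neg_sub]
  have h2 : (2 : ℝ) • ∑ i, diffusion a x i = 0 := by
    rw [two_smul]; nth_rewrite 2 [h]; exact add_neg_cancel _
  exact (smul_eq_zero.1 h2).resolve_left two_ne_zero

lemma StableWeights.sum_norm_sq_diffusion_le {a : ι → ι → ℝ} {β ρ : ℝ} (h : StableWeights a β ρ)
    (x : ι → E) :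
    ∑ i, ‖β • diffusion a x i‖ ^ 2 ≤ 2 * ρ * ∑ i, ⟪x i, β • diffusion a x i⟫ := by
  have h1 : ∀ i, ‖β • diffusion a x i‖ ^ 2 ≤ ρ * β * ∑ j, a i j * ‖x i - x j‖ ^ 2 := fun i => by
    have h2 : ‖diffusion a x i‖ ^ 2 ≤ (∑ j, a i j) * ∑ j, a i j * ‖x i - x j‖ ^ 2 := by
      calc ‖diffusion a x i‖ ^ 2 ≤ (∑ j, a i j * ‖x i - x j‖) ^ 2 := by
            gcongr
            refine norm_sum_le_of_le _ fun j _ => ?_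
            rw [norm_smul, Real.norm_of_nonneg (h.nonneg i j)]
        _ ≤ _ := Finset.sum_sq_le_sum_mul_sum_of_sq_le_mul _ (fun j _ => h.nonneg i j)
            (fun j _ => mul_nonneg (h.nonneg i j) (sq_nonneg _)) (fun j _ => le_of_eq (by ring))
    have hS : 0 ≤ ∑ j, a i j * ‖x i - x j‖ ^ 2 :=
      Finset.sum_nonneg fun j _ => mul_nonneg (h.nonneg i j) (sq_nonneg _)
    rw [norm_smul, mul_pow, Real.norm_of_nonneg h.step_nonneg]
    calc β ^ 2 * ‖diffusion a x i‖ ^ 2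
        ≤ β ^ 2 * ((∑ j, a i j) * ∑ j, a i j * ‖x i - x j‖ ^ 2) := by gcongr
      _ = (β * ∑ j, a i j) * (β * ∑ j, a i j * ‖x i - x j‖ ^ 2) := by ring
      _ ≤ ρ * (β * ∑ j, a i j * ‖x i - x j‖ ^ 2) :=
          mul_le_mul_of_nonneg_right (h.degree_le i) (mul_nonneg h.step_nonneg hS)
      _ = _ := by ring
  calc ∑ i, ‖β • diffusion a x i‖ ^ 2 ≤ ∑ i, ρ * β * ∑ j, a i j * ‖x i - x j‖ ^ 2 :=
        Finset.sum_le_sum fun i _ => h1 i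
    _ = ρ * β * energy a x := by rw [energy, Finset.mul_sum]
    _ = 2 * ρ * ∑ i, ⟪x i, β • diffusion a x i⟫ := by
        simp only [real_inner_smul_right, ← Finset.mul_sum, sum_inner_diffusion h.symm]; ring

/-! ### The step estimate and the disagreement -/

lemma norm_add_sq_le_mul {F : Type*} [SeminormedAddCommGroup F] (x y : F) {η : ℝ} (hη : 0 < η) :
    ‖x + y‖ ^ 2 ≤ (1 + η) * ‖x‖ ^ 2 + (1 + 1 / η) * ‖y‖ ^ 2 := by
  have h1 : ‖x + y‖ ^ 2 ≤ (‖x‖ + ‖y‖) ^ 2 := by gcongr; exact norm_add_le x y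
  have h2 : (1 + η) * ‖x‖ ^ 2 + (1 + 1 / η) * ‖y‖ ^ 2 - (‖x‖ + ‖y‖) ^ 2
      = (η * ‖x‖ - ‖y‖) ^ 2 / η := by field_simp; ring
  have h3 : 0 ≤ (η * ‖x‖ - ‖y‖) ^ 2 / η := by positivity
  linarith

lemma norm_add_sq_le_two_mul {F : Type*} [SeminormedAddCommGroup F] (x y : F) :
    ‖x + y‖ ^ 2 ≤ 2 * ‖x‖ ^ 2 + 2 * ‖y‖ ^ 2 := by
  have := norm_add_sq_le_mul x y one_pos
  norm_num at this
  exact this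

/-- One step `d ↦ d - ℓ - α (h + w)` with a dissipative `ℓ`, a strongly monotone and Lipschitz `h`
and a perturbation `w`. The dissipation `⟪d, ℓ⟫` absorbs the cross term `⟪ℓ, w⟫`, so that `w` need
not be uncorrelated with `ℓ`; only `⟪d, w⟫` is left to first order in `α`. -/
lemma norm_sq_step_le {d ℓ h w : E} {α μ L ρ : ℝ} (hρ : ρ < 1) (hα : 0 ≤ α)
    (hdℓ : 0 ≤ ⟪d, ℓ⟫) (hℓ : ‖ℓ‖ ^ 2 ≤ 2 * ρ * ⟪d, ℓ⟫) (hh : μ * ‖d‖ ^ 2 ≤ ⟪d, h⟫)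
    (hL : ‖h‖ ^ 2 ≤ L ^ 2 * ‖d‖ ^ 2) :
    ‖d - ℓ - α • (h + w)‖ ^ 2 ≤
      (1 - 2 * (α * μ) + 2 * (1 + 1 / (1 - ρ)) * L ^ 2 * α ^ 2) * ‖d‖ ^ 2 - 2 * α * ⟪d, w⟫
        + 2 * (1 + 1 / (1 - ρ)) * α ^ 2 * ‖w‖ ^ 2 := by
  have hρ' : 0 < 1 - ρ := by linarith
  set κ := 1 + 1 / (1 - ρ) with hκ
  have hκ0 : 0 < κ := by positivity
  have e : d - ℓ - α • (h + w) = d - (ℓ + α • (h + w)) := by abel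
  rw [e, norm_sub_sq_real, inner_add_right, real_inner_smul_right, inner_add_right]
  have h1 := norm_add_sq_le_mul ℓ (α • (h + w)) hρ'
  rw [← hκ, norm_smul, mul_pow, Real.norm_eq_abs, sq_abs] at h1
  have h2 : κ * α ^ 2 * ‖h + w‖ ^ 2 ≤ κ * α ^ 2 * (2 * (L ^ 2 * ‖d‖ ^ 2) + 2 * ‖w‖ ^ 2) := by
    gcongr
    have := norm_add_sq_le_two_mul h w
    linarith
  -- `(1 + (1 - ρ)) ρ = 1 - (1 - ρ)² ≤ 1`
  have h3 : (1 + (1 - ρ)) * ‖ℓ‖ ^ 2 ≤ 2 * ⟪d, ℓ⟫ := by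
    have := mul_le_mul_of_nonneg_left hℓ (by linarith : 0 ≤ 1 + (1 - ρ))
    nlinarith [mul_nonneg (sq_nonneg (1 - ρ)) hdℓ]
  have h4 := mul_le_mul_of_nonneg_left hh hα
  linarith

/-- The step estimate for a network: `norm_sq_step_le` in the Hilbert space of families of
vectors, with the diffusion as dissipative part. -/
lemma StableWeights.sum_norm_sq_step_le {a : ι → ι → ℝ} {β ρ α μ L : ℝ}
    (ha : StableWeights a β ρ) (hρ : ρ < 1) (hα : 0 ≤ α) (d h w : ι → E)
    (hh : ∀ i, μ * ‖d i‖ ^ 2 ≤ ⟪d i, h i⟫) (hL : ∀ i, ‖h i‖ ≤ L * ‖d i‖) :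
    ∑ i, ‖d i - β • diffusion a d i - α • (h i + w i)‖ ^ 2 ≤
      (1 - 2 * (α * μ) + 2 * (1 + 1 / (1 - ρ)) * L ^ 2 * α ^ 2) * ∑ i, ‖d i‖ ^ 2
        - 2 * α * ∑ i, ⟪d i, w i⟫ + 2 * (1 + 1 / (1 - ρ)) * α ^ 2 * ∑ i, ‖w i‖ ^ 2 := by
  have key := norm_sq_step_le (d := WithLp.toLp 2 d)
    (ℓ := WithLp.toLp 2 fun i => β • diffusion a d i) (h := WithLp.toLp 2 h)
    (w := WithLp.toLp 2 w) (μ := μ) (L := L) hρ hα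
  simp only [PiLp.norm_sq_eq_of_L2, PiLp.inner_apply, PiLp.sub_apply, PiLp.add_apply,
    PiLp.smul_apply] at key
  refine key ?_ (ha.sum_norm_sq_diffusion_le d) ?_ ?_
  · simp only [real_inner_smul_right, ← Finset.mul_sum, sum_inner_diffusion ha.symm]
    exact mul_nonneg ha.step_nonneg (div_nonneg (energy_nonneg ha.nonneg d) two_pos.le)
  · rw [Finset.mul_sum]
    exact Finset.sum_le_sum fun i _ => hh i
  · rw [Finset.mul_sum]
    refine Finset.sum_le_sum fun i _ => ?_
    rw [← mul_pow]
    gcongr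
    exact hL i

lemma sum_sub_mean [Nonempty ι] (x : ι → E) : ∑ i, (x i - mean x) = 0 := by
  have : (Fintype.card ι : ℝ) ≠ 0 := by exact_mod_cast Fintype.card_ne_zero
  rw [Finset.sum_sub_distrib, Finset.sum_const, Finset.card_univ, mean, ← Nat.cast_smul_eq_nsmul ℝ,
    smul_smul, mul_inv_cancel₀ this, one_smul, sub_self]

/-- Deviations from the mean are orthogonal to constants. -/
lemma sum_norm_sub_sq [Nonempty ι] (x : ι → E) (z : E) :
    ∑ i, ‖x i - z‖ ^ 2 = disagreement x + Fintype.card ι * ‖mean x - z‖ ^ 2 := by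
  have h : ∀ i, ‖x i - z‖ ^ 2 =
      ‖x i - mean x‖ ^ 2 + 2 * ⟪x i - mean x, mean x - z⟫ + ‖mean x - z‖ ^ 2 := fun i => by
    rw [← norm_add_sq_real]; congr 2; abel
  simp only [h, Finset.sum_add_distrib, ← Finset.mul_sum, ← sum_inner, sum_sub_mean, disagreement]
  simp

lemma disagreement_le [Nonempty ι] (x : ι → E) (z : E) :
    disagreement x ≤ ∑ i, ‖x i - z‖ ^ 2 := by
  rw [sum_norm_sub_sq x z]
  have : 0 ≤ Fintype.card ι * ‖mean x - z‖ ^ 2 := by positivity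
  linarith

lemma disagreement_nonneg (x : ι → E) : 0 ≤ disagreement x :=
  Finset.sum_nonneg fun _ _ => sq_nonneg _

lemma norm_mean_sq_le (x : ι → E) : ‖mean x‖ ^ 2 ≤ ∑ i, ‖x i‖ ^ 2 := by
  rcases isEmpty_or_nonempty ι with h | h
  · simp [mean]
  · have h1 := sum_norm_sub_sq x 0
    simp only [sub_zero] at h1
    have h2 := disagreement_nonneg x
    have h3 : (1 : ℝ) ≤ Fintype.card ι := by exact_mod_cast Fintype.card_pos
    nlinarith [sq_nonneg ‖mean x‖]

lemma mean_step {a : ι → ι → ℝ} (ha : ∀ i j, a i j = a j i) (x g : ι → E) (α β : ℝ) :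
    mean (fun i => x i - β • diffusion a x i - α • g i) = mean x - α • mean g := by
  simp only [mean, Finset.sum_sub_distrib, ← Finset.smul_sum, sum_diffusion ha, smul_zero,
    sub_zero, smul_sub]
  rw [smul_comm]

/-- The disagreement after one step with the perturbation `g`, in terms of the energy dissipated by the diffusion. -/
lemma StableWeights.disagreement_step_le [Nonempty ι] {a : ι → ι → ℝ} {β ρ α η : ℝ}
    (ha : StableWeights a β ρ) (hη : 0 < η) (x g : ι → E) :
    disagreement (fun i => x i - β • diffusion a x i - α • g i) ≤
      (1 + η) * (disagreement x - (1 - ρ) * β * energy a x)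
        + (1 + 1 / η) * α ^ 2 * ∑ i, ‖g i‖ ^ 2 := by
  set d : ι → E := fun i => x i - mean x with hd
  have hdiff : ∀ i, diffusion a d i = diffusion a x i := fun i => by
    rw [hd, diffusion_sub, diffusion_const, sub_zero]
  have hen : energy a d = energy a x := by simp [energy, hd]
  have h1 : ∑ i, ‖d i - β • diffusion a d i‖ ^ 2 ≤
      disagreement x - (1 - ρ) * β * energy a x := by
    have h2 := ha.sum_norm_sq_diffusion_le d
    simp only [norm_sub_sq_real, Finset.sum_add_distrib, Finset.sum_sub_distrib, ← Finset.mul_sum]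
    have h3 : ∑ i, ⟪d i, β • diffusion a d i⟫ = β * energy a x / 2 := by
      simp only [real_inner_smul_right, ← Finset.mul_sum, sum_inner_diffusion ha.symm, hen]; ring
    rw [h3] at h2 ⊢
    have h4 : disagreement x = ∑ i, ‖d i‖ ^ 2 := rfl
    rw [h4]; linarith
  have h5 : disagreement (fun i => x i - β • diffusion a x i - α • g i) =
      ∑ i, ‖(d i - β • diffusion a d i) + -(α • (g i - mean g))‖ ^ 2 := by
    rw [disagreement, mean_step ha.symm]
    refine Finset.sum_congr rfl fun i _ => ?_
    rw [hdiff, smul_sub]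
    congr 2
    simp only [hd]
    abel
  rw [h5]
  calc _ ≤ ∑ i, ((1 + η) * ‖d i - β • diffusion a d i‖ ^ 2
            + (1 + 1 / η) * ‖-(α • (g i - mean g))‖ ^ 2) :=
        Finset.sum_le_sum fun i _ => norm_add_sq_le_mul _ _ hη
    _ = (1 + η) * ∑ i, ‖d i - β • diffusion a d i‖ ^ 2
          + (1 + 1 / η) * α ^ 2 * disagreement g := by
        simp only [norm_neg, norm_smul, mul_pow, Real.norm_eq_abs, sq_abs, Finset.sum_add_distrib,
          ← Finset.mul_sum, disagreement]
        ring
    _ ≤ _ := by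
        have := disagreement_le g 0
        simp only [sub_zero] at this
        gcongr

/-- Along a connected graph, the energy of positive weights controls the disagreement. -/
lemma exists_mul_disagreement_le_energy [Nonempty ι] {a : ι → ι → ℝ} (ha : ∀ i j, 0 ≤ a i j)
    {H : SimpleGraph ι} (hH : H.Connected) (hadj : ∀ i j, H.Adj i j → 0 < a i j) :
    ∃ c > 0, ∀ x : ι → E, c * disagreement x ≤ energy a x := by
  have hpair : ∀ i j, ∃ C : ℝ, 0 ≤ C ∧ ∀ x : ι → E, ‖x i - x j‖ ^ 2 ≤ C * energy a x := by
    intro i j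
    -- induction along a walk from `i` to `j`
    obtain ⟨p⟩ := hH.preconnected i j
    induction p with
    | nil => exact ⟨0, le_rfl, fun x => by simp⟩
    | @cons u v w huv p ih =>
      obtain ⟨C, hC0, hC⟩ := ih
      have hpos := hadj u v huv
      refine ⟨2 * (1 / a u v) + 2 * C, by positivity, fun x => ?_⟩
      have h1 : a u v * ‖x u - x v‖ ^ 2 ≤ energy a x := by
        have h0 : ∀ i j, 0 ≤ a i j * ‖x i - x j‖ ^ 2 := fun i j => mul_nonneg (ha i j) (sq_nonneg _)
        exact (Finset.single_le_sum (f := fun j => a u j * ‖x u - x j‖ ^ 2)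
          (fun j _ => h0 u j) (Finset.mem_univ v)).trans
          (Finset.single_le_sum (f := fun i => ∑ j, a i j * ‖x i - x j‖ ^ 2)
            (fun i _ => Finset.sum_nonneg fun j _ => h0 i j) (Finset.mem_univ u))
      have h2 : ‖x u - x v‖ ^ 2 ≤ 1 / a u v * energy a x := by
        rw [div_mul_eq_mul_div, one_mul, le_div_iff₀ hpos]; linarith
      have h3 := norm_add_sq_le_two_mul (x u - x v) (x v - x w)
      rw [sub_add_sub_cancel] at h3
      have := hC x
      linarith
  choose C hC0 hC using hpair
  obtain ⟨i₀⟩ := ‹Nonempty ι›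
  have hS0 : 0 ≤ ∑ i, C i i₀ := Finset.sum_nonneg fun i _ => hC0 i i₀
  refine ⟨(∑ i, C i i₀ + 1)⁻¹, by positivity, fun x => ?_⟩
  rw [inv_mul_le_iff₀ (by positivity)]
  have := energy_nonneg ha x
  calc disagreement x ≤ ∑ i, ‖x i - x i₀‖ ^ 2 := disagreement_le x (x i₀)
    _ ≤ ∑ i, C i i₀ * energy a x := Finset.sum_le_sum fun i _ => hC i i₀ x
    _ ≤ (∑ i, C i i₀ + 1) * energy a x := by rw [← Finset.sum_mul]; linarith

end Diffusion

/-! ### The random graphs as random weights -/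

open scoped Classical in
/-- The adjacency matrix of `G` with real entries, as a system of weights. -/
def adjWeight {N : ℕ} (G : SimpleGraph (Fin N)) (i j : Fin N) : ℝ := if G.Adj i j then 1 else 0

section Weights

variable {N : ℕ} (G : SimpleGraph (Fin N))

lemma adjWeight_nonneg (i j : Fin N) : 0 ≤ adjWeight G i j := by
  unfold adjWeight; split_ifs <;> norm_num

lemma adjWeight_le_one (i j : Fin N) : adjWeight G i j ≤ 1 := by
  unfold adjWeight; split_ifs <;> norm_num

lemma adjWeight_comm (i j : Fin N) : adjWeight G i j = adjWeight G j i := by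
  unfold adjWeight
  congr 1
  exact propext (G.adj_comm i j)

lemma adjWeight_eq (i j : Fin N) :
    adjWeight G i j = if i = j then 0 else -laplacian G i j := by
  classical
  by_cases h : i = j
  · simp [h, adjWeight]
  · simp [h, adjWeight, laplacian, SimpleGraph.lapMatrix, SimpleGraph.degMatrix,
      SimpleGraph.adjMatrix_apply]

lemma sum_neighbors {m : ℕ} (x : Fin N → Vec m) (i : Fin N) :
    ∑ j ∈ neighbors G i, (x i - x j) = diffusion (adjWeight G) x i := by
  classical
  simp only [diffusion, adjWeight, ite_smul, one_smul, zero_smul, ← Finset.sum_filter]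
  congr 1
  ext j
  simp [neighbors]

lemma sum_adjWeight (i : Fin N) : ∑ j, adjWeight G i j = (neighbors G i).card := by
  classical
  simp only [adjWeight, Finset.sum_boole, Nat.cast_inj]
  congr 1
  ext j
  simp [neighbors]

lemma measurable_adjWeight {Ω : Type*} [MeasurableSpace Ω] {G : Ω → SimpleGraph (Fin N)}
    (hG : Measurable fun ω => laplacian (G ω)) (i j : Fin N) :
    Measurable fun ω => adjWeight (G ω) i j := by
  simp only [adjWeight_eq]
  split_ifs
  · exact measurable_const
  · have h : Measurable fun A : Matrix (Fin N) (Fin N) ℝ => A i j :=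
      (measurable_pi_apply j).comp (measurable_pi_apply (X := fun _ => Fin N → ℝ) i)
    exact (h.comp hG).neg

end Weights

/-! ### The step sizes -/

lemma stepAlpha_pos {α₀ : ℝ} (h : 0 < α₀) (k : ℕ) : 0 < stepAlpha α₀ k := by
  unfold stepAlpha; positivity

lemma stepBeta_pos {β₀ : ℝ} (h : 0 < β₀) (ν : ℝ) (k : ℕ) : 0 < stepBeta β₀ ν k := by
  unfold stepBeta; positivity

lemma stepBeta_le {β₀ ν : ℝ} (h : 0 < β₀) (hν : 0 ≤ ν) (k : ℕ) : stepBeta β₀ ν k ≤ β₀ := by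
  unfold stepBeta
  refine div_le_self h.le (Real.one_le_rpow ?_ hν)
  linarith [(Nat.cast_nonneg k : (0 : ℝ) ≤ k)]

lemma sq_div_le_stepBeta_sq {β₀ ν : ℝ} (hν : ν ≤ 1 / 2) (k : ℕ) :
    β₀ ^ 2 / ((k : ℝ) + 1) ≤ stepBeta β₀ ν k ^ 2 := by
  unfold stepBeta
  have hk : (1 : ℝ) ≤ (k : ℝ) + 1 := by linarith [(Nat.cast_nonneg k : (0 : ℝ) ≤ k)]
  rw [div_pow]
  gcongr
  calc (((k : ℝ) + 1) ^ ν) ^ 2 = ((k : ℝ) + 1) ^ (ν * 2) := by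
        rw [← Real.rpow_natCast, ← Real.rpow_mul (by positivity)]; norm_num
    _ ≤ ((k : ℝ) + 1) ^ (1 : ℝ) := Real.rpow_le_rpow_of_exponent_le hk (by linarith)
    _ = _ := Real.rpow_one _

lemma tendsto_stepAlpha (α₀ : ℝ) : Tendsto (stepAlpha α₀) atTop (nhds 0) :=
  tendsto_const_nhds.div_atTop (tendsto_atTop_add_const_right _ _ tendsto_natCast_atTop_atTop)

lemma tendsto_stepBeta (β₀ : ℝ) {ν : ℝ} (hν : 0 < ν) : Tendsto (stepBeta β₀ ν) atTop (nhds 0) :=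
  tendsto_const_nhds.div_atTop ((tendsto_rpow_atTop hν).comp
    (tendsto_atTop_add_const_right _ _ tendsto_natCast_atTop_atTop))

/-- Eventually, the diffusion steps are uniformly inside the stability range: for `ν > 0` because
`β_k → 0`, for `ν = 0` because the degrees are integers, so that a degree below `1 / β₀` is at
most `⌈1 / β₀⌉ - 1`. -/
lemma exists_eventually_stableWeights {Ω : Type*} [MeasurableSpace Ω] {P : Measure Ω} {N : ℕ}
    {G : ℕ → Ω → SimpleGraph (Fin N)} {β₀ ν : ℝ} (hβ : 0 < β₀) (hν : 0 ≤ ν)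
    (hsmall : ν = 0 → ∀ k i, ∀ᵐ ω ∂P, β₀ * ((neighbors (G k ω) i).card : ℝ) < 1) :
    ∃ ρ < 1, ∀ᶠ k in atTop, ∀ᵐ ω ∂P, StableWeights (adjWeight (G k ω)) (stepBeta β₀ ν k) ρ := by
  suffices h : ∃ ρ < 1, ∀ᶠ k in atTop, ∀ᵐ ω ∂P, ∀ i,
      stepBeta β₀ ν k * ((neighbors (G k ω) i).card : ℝ) ≤ ρ by
    obtain ⟨ρ, hρ, h⟩ := h
    refine ⟨ρ, hρ, h.mono fun k hk => hk.mono fun ω hω => ?_⟩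
    exact ⟨adjWeight_comm _, adjWeight_nonneg _, (stepBeta_pos hβ ν k).le,
      fun i => by rw [sum_adjWeight]; exact hω i⟩
  rcases hν.eq_or_lt with h0 | h0
  · refine ⟨β₀ * ((⌈1 / β₀⌉₊ - 1 : ℕ) : ℝ), ?_, Eventually.of_forall fun k => ?_⟩
    · have h1 : ⌈1 / β₀⌉₊ - 1 < ⌈1 / β₀⌉₊ :=
        Nat.sub_lt (Nat.ceil_pos.2 (by positivity)) one_pos
      have h2 := Nat.lt_ceil.1 h1
      rwa [lt_div_iff₀ hβ, mul_comm] at h2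
    · filter_upwards [ae_all_iff.2 (hsmall h0.symm k)] with ω hω i
      have h1 : stepBeta β₀ ν k = β₀ := by simp [stepBeta, ← h0]
      rw [h1]
      gcongr
      refine Nat.le_sub_one_of_lt (Nat.lt_ceil.2 ?_)
      rw [lt_div_iff₀ hβ, mul_comm]
      exact hω i
  · refine ⟨1 / 2, by norm_num, ?_⟩
    have h1 : Tendsto (fun k => stepBeta β₀ ν k * (N : ℝ)) atTop (nhds 0) := by
      simpa using (tendsto_stepBeta β₀ h0).mul_const (N : ℝ)
    filter_upwards [h1.eventually_le_const (by norm_num : (0 : ℝ) < 1 / 2)] with k hk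
    refine Eventually.of_forall fun ω i => le_trans ?_ hk
    have := (stepBeta_pos hβ ν k).le
    gcongr
    simpa using Finset.card_le_univ (neighbors (G k ω) i)

/-! ### Measurability and square integrability of the iterates -/

section Iterates

variable {Ω : Type*} {N m : ℕ} {f : Fin N → Vec m → ℝ} {μ L : ℝ}
  {G : ℕ → Ω → SimpleGraph (Fin N)} {v : Fin N → ℕ → Ω → Vec m} {α β : ℕ → ℝ}
  {x₀ : Fin N → Vec m}

lemma iterate_succ (k : ℕ) (ω : Ω) (i : Fin N) :
    iterate f G v α β x₀ (k + 1) ω i =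
      iterate f G v α β x₀ k ω i
        - β k • diffusion (adjWeight (G k ω)) (iterate f G v α β x₀ k ω) i
        - α k • (gradient (f i) (iterate f G v α β x₀ k ω i) + v i k ω) := by
  rw [← sum_neighbors]; rfl

lemma CostAssumption.continuous_gradient (hf : CostAssumption f μ L) (i : Fin N) :
    Continuous (gradient (f i)) := (hf.differentiable_gradient i).continuous

lemma measurable_iterate [MeasurableSpace Ω] (hf : CostAssumption f μ L) (k : ℕ)
    (hG : ∀ s < k, Measurable fun ω => laplacian (G s ω))
    (hv : ∀ i, ∀ s < k, Measurable (v i s)) (i : Fin N) :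
    Measurable fun ω => iterate f G v α β x₀ k ω i := by
  induction k generalizing i with
  | zero => exact measurable_const
  | succ k ih =>
    have ih' := ih (fun s hs => hG s (hs.trans k.lt_succ_self))
      (fun i s hs => hv i s (hs.trans k.lt_succ_self))
    have h1 : Measurable fun ω => diffusion (adjWeight (G k ω)) (iterate f G v α β x₀ k ω) i :=
      Finset.measurable_fun_sum _ fun j _ =>
        (measurable_adjWeight (hG k k.lt_succ_self) i j).smul ((ih' i).sub (ih' j))
    have h2 : Measurable fun ω => gradient (f i) (iterate f G v α β x₀ k ω i) + v i k ω :=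
      ((hf.continuous_gradient i).measurable.comp (ih' i)).add (hv i k k.lt_succ_self)
    simp only [iterate_succ]
    exact ((ih' i).sub (h1.const_smul (β k))).sub (h2.const_smul (α k))

lemma measurable_norm_sub_sq [MeasurableSpace Ω] {X Y : Ω → Vec m} (hX : Measurable X)
    (hY : Measurable Y) : Measurable fun ω => ‖X ω - Y ω‖ ^ 2 :=
  (hX.sub hY).norm.pow_const 2

variable {mΩ : MeasurableSpace Ω} {P : Measure Ω}

lemma CostAssumption.memLp_gradient [IsFiniteMeasure P] (hf : CostAssumption f μ L) (i : Fin N)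
    {X : Ω → Vec m} (hX : MemLp X 2 P) : MemLp (fun ω => gradient (f i) (X ω)) 2 P := by
  have h : MemLp (fun ω => ‖gradient (f i) 0‖ + L * ‖X ω‖) 2 P :=
    (memLp_const ‖gradient (f i) 0‖).add (hX.norm.const_mul L)
  refine h.mono ((hf.continuous_gradient i).comp_aestronglyMeasurable hX.1)
    (Eventually.of_forall fun ω => ?_)
  exact (hf.norm_gradient_le i _).trans (le_abs_self _)

lemma memLp_iterate [IsFiniteMeasure P] (hf : CostAssumption f μ L)
    (hG : ∀ s, Measurable fun ω => laplacian (G s ω)) (hv : ∀ i k, MemLp (v i k) 2 P)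
    (k : ℕ) (i : Fin N) : MemLp (fun ω => iterate f G v α β x₀ k ω i) 2 P := by
  induction k generalizing i with
  | zero => exact memLp_const _
  | succ k ih =>
    have h1 : MemLp (fun ω => diffusion (adjWeight (G k ω)) (iterate f G v α β x₀ k ω) i) 2 P := by
      refine memLp_finsetSum _ fun j _ => ?_
      refine ((ih i).sub (ih j)).mono
        ((measurable_adjWeight (hG k) i j).aestronglyMeasurable.smul ((ih i).sub (ih j)).1)
        (Eventually.of_forall fun ω => ?_)
      rw [norm_smul, Real.norm_of_nonneg (adjWeight_nonneg _ _ _)]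
      exact mul_le_of_le_one_left (norm_nonneg _) (adjWeight_le_one _ _ _)
    have h2 : MemLp (fun ω => gradient (f i) (iterate f G v α β x₀ k ω i) + v i k ω) 2 P :=
      (hf.memLp_gradient i (ih i)).add (hv i k)
    simp only [iterate_succ]
    exact ((ih i).sub (h1.const_smul (β k))).sub (h2.const_smul (α k))

lemma integrable_norm_sq {E : Type*} [NormedAddCommGroup E] {X : Ω → E} (hX : MemLp X 2 P) :
    Integrable (fun ω => ‖X ω‖ ^ 2) P :=
  (memLp_two_iff_integrable_sq_norm hX.1).1 hX

lemma integrable_sum_norm_sq {ι E : Type*} [Fintype ι] [NormedAddCommGroup E] {X : Ω → ι → E}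
    (hX : ∀ i, MemLp (fun ω => X ω i) 2 P) : Integrable (fun ω => ∑ i, ‖X ω i‖ ^ 2) P :=
  integrable_finsetSum _ fun i _ => integrable_norm_sq (hX i)

lemma memLp_mean {ι E : Type*} [Fintype ι] [NormedAddCommGroup E] [InnerProductSpace ℝ E]
    {X : Ω → ι → E} (hX : ∀ i, MemLp (fun ω => X ω i) 2 P) : MemLp (fun ω => mean (X ω)) 2 P := by
  have h : MemLp (fun ω => ∑ i, X ω i) 2 P := memLp_finsetSum _ fun i _ => hX i
  exact h.const_smul (Fintype.card ι : ℝ)⁻¹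

lemma integrable_disagreement {ι E : Type*} [Fintype ι] [NormedAddCommGroup E]
    [InnerProductSpace ℝ E] {X : Ω → ι → E} (hX : ∀ i, MemLp (fun ω => X ω i) 2 P) :
    Integrable (fun ω => disagreement (X ω)) P :=
  integrable_finsetSum _ fun i _ => integrable_norm_sq ((hX i).sub (memLp_mean hX))

/-! ### The noise -/

lemma integrable_inner_of_memLp {E : Type*} [NormedAddCommGroup E] [InnerProductSpace ℝ E]
    {Z V : Ω → E} (hZ : MemLp Z 2 P) (hV : MemLp V 2 P) :
    Integrable (fun ω => ⟪Z ω, V ω⟫) P := by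
  refine ((integrable_norm_sq hZ).add (integrable_norm_sq hV)).mono' (hZ.1.inner hV.1)
    (Eventually.of_forall fun ω => (norm_inner_le_norm _ _).trans ?_)
  simp only [Pi.add_apply]
  nlinarith [sq_nonneg (‖Z ω‖ - ‖V ω‖), sq_nonneg (‖Z ω‖ + ‖V ω‖)]

/-- A square integrable random vector with vanishing conditional mean is orthogonal to every
square integrable vector known to the conditioning σ-algebra. -/
lemma integral_inner_eq_zero_of_condExp {E : Type*} [NormedAddCommGroup E] [InnerProductSpace ℝ E]
    [CompleteSpace E] [IsFiniteMeasure P] {𝓕 : MeasurableSpace Ω} (h𝓕 : 𝓕 ≤ mΩ)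
    {Z V : Ω → E} (hZm : StronglyMeasurable[𝓕] Z) (hZ : MemLp Z 2 P) (hV : MemLp V 2 P)
    (h : P[V | 𝓕] =ᵐ[P] 0) : ∫ ω, ⟪Z ω, V ω⟫ ∂P = 0 := by
  have hint : Integrable (fun ω => ⟪Z ω, V ω⟫) P := integrable_inner_of_memLp hZ hV
  have key := condExp_bilin_of_stronglyMeasurable_left (innerSL ℝ) hZm
    (g := V) (μ := P) hint (hV.integrable one_le_two)
  rw [← integral_condExp h𝓕 (f := fun ω => ⟪Z ω, V ω⟫), ← integral_zero Ω ℝ (μ := P)]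
  refine integral_congr_ae ?_
  filter_upwards [key, h] with ω h1 h2
  rw [h2] at h1
  exact h1.trans (by simp)

lemma history_le (hG : ∀ k, Measurable fun ω => laplacian (G k ω))
    (hv : ∀ i k, Measurable (v i k)) (k : ℕ) : history G v k ≤ mΩ :=
  sup_le (iSup_le fun s => (hG s).comap_le)
    (iSup_le fun i => iSup_le fun t => (hv i t).comap_le)

lemma measurable_laplacian_history {k s : ℕ} (hs : s < k) :
    Measurable[history G v k] fun ω => laplacian (G s ω) :=
  Measurable.of_comap_le ((le_iSup (fun s : Fin k => MeasurableSpace.comap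
    (fun ω => laplacian (G s ω)) inferInstance) ⟨s, hs⟩).trans le_sup_left)

lemma measurable_noise_history {k s : ℕ} (hs : s < k) (i : Fin N) :
    Measurable[history G v k] (v i s) :=
  Measurable.of_comap_le (((le_iSup (fun t : Fin k => MeasurableSpace.comap
    (v i t) inferInstance) ⟨s, hs⟩).trans (le_iSup (fun i : Fin N => ⨆ t : Fin k,
      MeasurableSpace.comap (v i t) inferInstance) i)).trans le_sup_right)

lemma integral_sum_noise_le [IsProbabilityMeasure P] {c c' : ℝ} {x : ℕ → Ω → Fin N → Vec m}
    (hG : ∀ k, Measurable fun ω => laplacian (G k ω)) (hv : NoiseAssumption P G v x c c')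
    (hx : ∀ k i, MemLp (fun ω => x k ω i) 2 P) (k : ℕ) :
    ∫ ω, ∑ i, ‖v i k ω‖ ^ 2 ∂P ≤ c * ∫ ω, ∑ i, ‖x k ω i‖ ^ 2 ∂P + N * c' := by
  rw [integral_finsetSum _ fun i _ => integrable_norm_sq (hv.memLp i k),
    integral_finsetSum _ fun i _ => integrable_norm_sq (hx k i), Finset.mul_sum]
  have h : ∀ i, ∫ ω, ‖v i k ω‖ ^ 2 ∂P ≤ c * ∫ ω, ‖x k ω i‖ ^ 2 ∂P + c' := fun i => by
    rw [← integral_condExp (history_le hG hv.measurable k)]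
    refine (integral_mono_ae integrable_condExp
      (((integrable_norm_sq (hx k i)).const_mul c).add (integrable_const c'))
      (hv.condSq i k)).trans ?_
    rw [integral_add' ((integrable_norm_sq (hx k i)).const_mul c) (integrable_const c'),
      integral_const_mul]
    simp
  calc _ ≤ ∑ i, (c * ∫ ω, ‖x k ω i‖ ^ 2 ∂P + c') := Finset.sum_le_sum fun i _ => h i
    _ = _ := by simp [Finset.sum_add_distrib]

/-! ### The mean energy of the noiseless iterates -/

/-- The σ-algebra generated by the Laplacians before time `k`. -/
@[reducible] def graphHistory (G : ℕ → Ω → SimpleGraph (Fin N)) (k : ℕ) : MeasurableSpace Ω :=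
  ⨆ s ∈ Set.Iio k, MeasurableSpace.comap (fun ω => laplacian (G s ω)) inferInstance

lemma measurable_laplacian_graphHistory {k s : ℕ} (hs : s < k) :
    Measurable[graphHistory G k] fun ω => laplacian (G s ω) :=
  Measurable.of_comap_le (le_iSup₂ (f := fun (s : ℕ) (_ : s ∈ Set.Iio k) =>
    MeasurableSpace.comap (fun ω => laplacian (G s ω)) inferInstance) s hs)

lemma NetworkAssumption.indep_graphHistory (hG : NetworkAssumption P G) (k : ℕ) :
    Indep (MeasurableSpace.comap (fun ω => laplacian (G k ω)) inferInstance)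
      (graphHistory G k) P := by
  have h := indep_iSup_of_disjoint (S := {k}) (T := Set.Iio k)
    (fun s => (hG.measurable s).comap_le) hG.indep (by simp)
  rwa [iSup_singleton] at h

/-- The noiseless iterate at time `k` depends on the graphs before `k` only, so the weights at
time `k` enter its mean energy through their expectations. -/
lemma integral_energy_iterate [IsProbabilityMeasure P] (hf : CostAssumption f μ L)
    (hG : NetworkAssumption P G) (k : ℕ) :
    ∫ ω, energy (adjWeight (G k ω)) (iterate f G (fun _ _ _ => 0) α β x₀ k ω) ∂P =
      ∫ ω, energy (fun i j => ∫ ω', adjWeight (G 0 ω') i j ∂P)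
        (iterate f G (fun _ _ _ => 0) α β x₀ k ω) ∂P := by
  set y : Ω → Fin N → Vec m := iterate f G (fun _ _ _ => 0) α β x₀ k with hy
  have hyL : ∀ i, MemLp (fun ω => y ω i) 2 P := fun i =>
    memLp_iterate hf hG.measurable (fun _ _ => MemLp.zero) k i
  have hym : ∀ i, Measurable[graphHistory G k] fun ω => y ω i :=
    @measurable_iterate Ω N m f μ L G _ α β x₀ (graphHistory G k) hf k
      (fun s hs => measurable_laplacian_graphHistory hs) (fun _ _ _ => measurable_const)
  have hterm : ∀ i j, Integrable (fun ω => adjWeight (G k ω) i j * ‖y ω i - y ω j‖ ^ 2) P ∧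
      ∫ ω, adjWeight (G k ω) i j * ‖y ω i - y ω j‖ ^ 2 ∂P =
        ∫ ω, (∫ ω', adjWeight (G 0 ω') i j ∂P) * ‖y ω i - y ω j‖ ^ 2 ∂P := fun i j => by
    have hm : Measurable[graphHistory G k] fun ω => ‖y ω i - y ω j‖ ^ 2 :=
      @measurable_norm_sub_sq Ω m (graphHistory G k) _ _ (hym i) (hym j)
    have ha : Measurable[MeasurableSpace.comap (fun ω => laplacian (G k ω)) inferInstance]
        fun ω => adjWeight (G k ω) i j :=
      @measurable_adjWeight N Ω (MeasurableSpace.comap (fun ω => laplacian (G k ω)) inferInstance)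
        (G k) (comap_measurable _) i j
    have hI : IndepFun (fun ω => adjWeight (G k ω) i j) (fun ω => ‖y ω i - y ω j‖ ^ 2) P :=
      indep_of_indep_of_le_left
        (indep_of_indep_of_le_right (hG.indep_graphHistory k) hm.comap_le) ha.comap_le
    have hyI : Integrable (fun ω => ‖y ω i - y ω j‖ ^ 2) P :=
      integrable_norm_sq ((hyL i).sub (hyL j))
    have haI : Integrable (fun ω => adjWeight (G k ω) i j) P :=
      Integrable.of_bound (measurable_adjWeight (hG.measurable k) i j).aestronglyMeasurable 1
        (Eventually.of_forall fun ω => by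
          rw [Real.norm_of_nonneg (adjWeight_nonneg _ _ _)]; exact adjWeight_le_one _ _ _)
    have hid : ∫ ω, adjWeight (G k ω) i j ∂P = ∫ ω, adjWeight (G 0 ω) i j ∂P := by
      simp only [adjWeight_eq]
      split_ifs
      · rfl
      · have hmeas : Measurable fun A : Matrix (Fin N) (Fin N) ℝ => -A i j :=
          ((measurable_pi_apply j).comp (measurable_pi_apply (X := fun _ => Fin N → ℝ) i)).neg
        exact ((hG.identDistrib k).comp hmeas).integral_eq
    refine ⟨hI.integrable_mul haI hyI, ?_⟩
    rw [hI.integral_fun_mul_eq_mul_integral haI.1 hyI.1, integral_const_mul, hid]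
  have hint : ∀ i j, Integrable
      (fun ω => (∫ ω', adjWeight (G 0 ω') i j ∂P) * ‖y ω i - y ω j‖ ^ 2) P := fun i j =>
    (integrable_norm_sq ((hyL i).sub (hyL j))).const_mul _
  simp only [energy]
  rw [integral_finsetSum _ fun i _ => integrable_finsetSum _ fun j _ => (hterm i j).1,
    integral_finsetSum _ fun i _ => integrable_finsetSum _ fun j _ => hint i j]
  refine Finset.sum_congr rfl fun i _ => ?_
  rw [integral_finsetSum _ fun j _ => (hterm i j).1, integral_finsetSum _ fun j _ => hint i j]
  exact Finset.sum_congr rfl fun j _ => (hterm i j).2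

/-- The mean graph is connected, so the mean energy of the noiseless iterates is at least a
multiple of their mean disagreement. -/
lemma exists_mul_integral_disagreement_le [NeZero N] [IsProbabilityMeasure P]
    (hf : CostAssumption f μ L) (hG : NetworkAssumption P G) :
    ∃ c > 0, ∀ k, c * ∫ ω, disagreement (iterate f G (fun _ _ _ => 0) α β x₀ k ω) ∂P ≤
      ∫ ω, energy (adjWeight (G k ω)) (iterate f G (fun _ _ _ => 0) α β x₀ k ω) ∂P := by
  have hadj : ∀ i j, (inducedGraph (meanLaplacian P (G 0))).Adj i j →
      0 < ∫ ω', adjWeight (G 0 ω') i j ∂P := by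
    have h1 : ∀ i j, i ≠ j → meanLaplacian P (G 0) i j < 0 →
        0 < ∫ ω', adjWeight (G 0 ω') i j ∂P := fun i j hij h => by
      simp only [adjWeight_eq, if_neg hij, integral_neg]
      simpa [meanLaplacian] using h
    intro i j hij
    obtain ⟨hne, h | h⟩ := (SimpleGraph.fromRel_adj _ _ _).1 hij
    · exact h1 i j hne h
    · simpa only [adjWeight_comm _ i j] using h1 j i hne.symm h
  obtain ⟨c, hc, hle⟩ := exists_mul_disagreement_le_energy (E := Vec m)
    (a := fun i j => ∫ ω', adjWeight (G 0 ω') i j ∂P)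
    (fun i j => integral_nonneg fun ω => adjWeight_nonneg _ _ _) hG.connected hadj
  refine ⟨c, hc, fun k => ?_⟩
  have hyL : ∀ i, MemLp (fun ω => iterate f G (fun _ _ _ => 0) α β x₀ k ω i) 2 P := fun i =>
    memLp_iterate hf hG.measurable (fun _ _ => MemLp.zero) k i
  rw [integral_energy_iterate hf hG, ← integral_const_mul]
  refine integral_mono ((integrable_disagreement hyL).const_mul c) ?_ fun ω => hle _
  exact integrable_finsetSum _ fun i _ => integrable_finsetSum _ fun j _ =>
    (integrable_norm_sq ((hyL i).sub (hyL j))).const_mul _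

end Iterates

/-! ### Recursions with the step sizes of the method -/

lemma eventually_mul_sq_stepAlpha_le {α₀ μ : ℝ} (hα : 0 < α₀) (hμ : 0 < μ) (C : ℝ) :
    ∀ᶠ k in atTop, C * stepAlpha α₀ k ^ 2 ≤ stepAlpha α₀ k * μ / 4 := by
  have h : Tendsto (fun k => C * stepAlpha α₀ k) atTop (nhds 0) := by
    simpa using (tendsto_stepAlpha α₀).const_mul C
  filter_upwards [h.eventually_le_const (by positivity : 0 < μ / 4)] with k hk
  nlinarith [stepAlpha_pos hα k]

lemma eventually_stepAlpha_mul_le_one (α₀ μ : ℝ) :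
    ∀ᶠ k in atTop, 3 / 4 * (stepAlpha α₀ k * μ) ≤ 1 := by
  have h : Tendsto (fun k => 3 / 4 * (stepAlpha α₀ k * μ)) atTop (nhds 0) := by
    simpa using ((tendsto_stepAlpha α₀).mul_const μ).const_mul (3 / 4)
  exact h.eventually_le_const one_pos

lemma stepAlpha_le {α₀ : ℝ} (hα : 0 < α₀) (k : ℕ) : stepAlpha α₀ k ≤ α₀ :=
  div_le_self hα.le (by linarith [(Nat.cast_nonneg k : (0 : ℝ) ≤ k)])

lemma stepAlpha_sq (α₀ : ℝ) (k : ℕ) :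
    stepAlpha α₀ k ^ 2 = α₀ * (stepAlpha α₀ k / ((k : ℝ) + 1)) := by
  unfold stepAlpha; ring

/-- A quarter of the contraction `α_k μ` absorbs the term `C α_k²`, which leaves the rate
`3/4 α_k μ`. -/
lemma eventually_bounded_of_stepAlpha {a : ℕ → ℝ} {α₀ μ C W : ℝ} (hα : 0 < α₀) (hμ : 0 < μ)
    (ha : ∀ k, 0 ≤ a k)
    (h : ∀ᶠ k in atTop, a (k + 1) ≤
      (1 - stepAlpha α₀ k * μ + C * stepAlpha α₀ k ^ 2) * a k + W * stepAlpha α₀ k) :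
    ∃ M, 0 ≤ M ∧ ∀ᶠ k in atTop, a k ≤ M := by
  refine eventually_bounded_of_recursion (γ := fun k => 3 / 4 * (stepAlpha α₀ k * μ))
    (B := W * 4 / (3 * μ)) (Eventually.of_forall fun k => ?_)
    (eventually_stepAlpha_mul_le_one α₀ μ) ?_
  · have := stepAlpha_pos hα k
    positivity
  · filter_upwards [h, eventually_mul_sq_stepAlpha_le hα hμ C] with k h1 h2
    have h3 := mul_le_mul_of_nonneg_right h2 (ha k)
    have h4 : W * 4 / (3 * μ) * (3 / 4 * (stepAlpha α₀ k * μ)) = W * stepAlpha α₀ k := by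
      field_simp
    rw [h4]; linarith

/-- As in `eventually_bounded_of_stepAlpha`, the rate left is `3/4 α_k μ`, and
`3/4 α₀ μ ≥ 3/2 > 1` suffices for a decay of order `1 / k`. -/
lemma eventually_le_div_of_stepAlpha {a : ℕ → ℝ} {α₀ μ C W : ℝ} (hα : 0 < α₀) (hμ : 0 < μ)
    (hαμ : 2 < α₀ * μ) (ha : ∀ k, 0 ≤ a k)
    (h : ∀ᶠ k : ℕ in atTop, a (k + 1) ≤
      (1 - stepAlpha α₀ k * μ + C * stepAlpha α₀ k ^ 2) * a k
        + W * (stepAlpha α₀ k / ((k : ℝ) + 1))) :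
    ∃ M, 0 ≤ M ∧ ∀ᶠ k : ℕ in atTop, a k ≤ M / ((k : ℝ) + 1) := by
  refine eventually_le_div_of_recursion (γ := fun k => 3 / 4 * (stepAlpha α₀ k * μ))
    (B := W * 4 / (3 * μ)) (r := 3 / 2) (by norm_num)
    (eventually_stepAlpha_mul_le_one α₀ μ) (Eventually.of_forall fun k => ?_) ?_
  · have : 3 / 4 * (stepAlpha α₀ k * μ) * ((k : ℝ) + 1) = 3 / 4 * (α₀ * μ) := by
      unfold stepAlpha; field_simp
    rw [this]; linarith
  · filter_upwards [h, eventually_mul_sq_stepAlpha_le hα hμ C] with k h1 h2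
    have h3 := mul_le_mul_of_nonneg_right h2 (ha k)
    have h4 : W * 4 / (3 * μ) * (3 / 4 * (stepAlpha α₀ k * μ)) / ((k : ℝ) + 1)
        = W * (stepAlpha α₀ k / ((k : ℝ) + 1)) := by
      field_simp
    rw [h4]; linarith

/-! ### One step of the method, pathwise -/

section Pathwise

variable {N m : ℕ} {f : Fin N → Vec m → ℝ} {μ L : ℝ}

/-- The distance between two runs with the same graph and different perturbations. -/
lemma CostAssumption.sum_norm_sq_step_sub_le (hf : CostAssumption f μ L)
    {a : Fin N → Fin N → ℝ} {α β ρ : ℝ} (ha : StableWeights a β ρ) (hρ : ρ < 1) (hα : 0 ≤ α)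
    (x z v w : Fin N → Vec m) :
    ∑ i, ‖(x i - β • diffusion a x i - α • (gradient (f i) (x i) + v i))
        - (z i - β • diffusion a z i - α • (gradient (f i) (z i) + w i))‖ ^ 2 ≤
      (1 - 2 * (α * μ) + 2 * (1 + 1 / (1 - ρ)) * L ^ 2 * α ^ 2) * ∑ i, ‖x i - z i‖ ^ 2
        - 2 * α * ∑ i, ⟪x i - z i, v i - w i⟫
        + 2 * (1 + 1 / (1 - ρ)) * α ^ 2 * ∑ i, ‖v i - w i‖ ^ 2 := by
  have key := ha.sum_norm_sq_step_le hρ hα (fun i => x i - z i)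
    (fun i => gradient (f i) (x i) - gradient (f i) (z i)) (fun i => v i - w i)
    (μ := μ) (L := L) (fun i => hf.le_inner_gradient_sub i _ _)
    (fun i => hf.norm_gradient_sub_le i _ _)
  refine le_trans (le_of_eq (Finset.sum_congr rfl fun i _ => ?_)) key
  rw [diffusion_sub]
  congr 2
  simp only [smul_sub, smul_add]
  abel

lemma two_mul_inner_le {E : Type*} [NormedAddCommGroup E] [InnerProductSpace ℝ E] (d w : E)
    {μ : ℝ} (hμ : 0 < μ) : -(2 * ⟪d, w⟫) ≤ μ * ‖d‖ ^ 2 + 1 / μ * ‖w‖ ^ 2 := by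
  have h1 := (abs_le.1 (abs_real_inner_le_norm d w)).1
  have h2 : μ * ‖d‖ ^ 2 + 1 / μ * ‖w‖ ^ 2 - 2 * (‖d‖ * ‖w‖) = (μ * ‖d‖ - ‖w‖) ^ 2 / μ := by
    field_simp; ring
  have h3 : 0 ≤ (μ * ‖d‖ - ‖w‖) ^ 2 / μ := by positivity
  linarith

/-- The distance of a noiseless run to the solution; the gradients at the solution act as
a perturbation. -/
lemma CostAssumption.sum_norm_sq_step_sub_solution_le (hf : CostAssumption f μ L)
    {a : Fin N → Fin N → ℝ} {α β ρ : ℝ} (ha : StableWeights a β ρ) (hρ : ρ < 1) (hα : 0 ≤ α)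
    (y : Fin N → Vec m) (xs : Vec m) :
    ∑ i, ‖(y i - β • diffusion a y i - α • (gradient (f i) (y i) + 0)) - xs‖ ^ 2 ≤
      (1 - α * μ + 2 * (1 + 1 / (1 - ρ)) * L ^ 2 * α ^ 2) * ∑ i, ‖y i - xs‖ ^ 2
        + (α / μ + 2 * (1 + 1 / (1 - ρ)) * α ^ 2) * ∑ i, ‖gradient (f i) xs‖ ^ 2 := by
  have key := hf.sum_norm_sq_step_sub_le ha hρ hα y (fun _ => xs) (fun _ => 0)
    (fun i => -gradient (f i) xs)
  simp only [diffusion_const, smul_zero, sub_zero, zero_sub, neg_neg, add_neg_cancel] at key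
  have h1 : -(2 * ∑ i, ⟪y i - xs, gradient (f i) xs⟫) ≤
      μ * ∑ i, ‖y i - xs‖ ^ 2 + 1 / μ * ∑ i, ‖gradient (f i) xs‖ ^ 2 := by
    rw [Finset.mul_sum, Finset.mul_sum, Finset.mul_sum, ← Finset.sum_add_distrib,
      ← Finset.sum_neg_distrib]
    exact Finset.sum_le_sum fun i _ => two_mul_inner_le _ _ hf.mu_pos
  have h2 := mul_le_mul_of_nonneg_left h1 hα
  have h3 : α / μ * ∑ i, ‖gradient (f i) xs‖ ^ 2
      = α * (1 / μ * ∑ i, ‖gradient (f i) xs‖ ^ 2) := by ring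
  linarith

lemma mean_add {ι E : Type*} [Fintype ι] [NormedAddCommGroup E] [InnerProductSpace ℝ E]
    (x y : ι → E) : mean (fun i => x i + y i) = mean x + mean y := by
  simp [mean, Finset.sum_add_distrib]

/-- The average of a noiseless run follows the gradient method for the average cost, up to an
error controlled by the disagreement. -/
lemma CostAssumption.norm_sq_mean_step_sub_le [NeZero N] (hf : CostAssumption f μ L)
    {a : Fin N → Fin N → ℝ} (ha : ∀ i j, a i j = a j i) {α : ℝ} (hα : 0 ≤ α) (β : ℝ)
    {xs : Vec m} (hxs : ∑ i, gradient (f i) xs = 0) (y : Fin N → Vec m) :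
    ‖mean (fun i => y i - β • diffusion a y i - α • (gradient (f i) (y i) + 0)) - xs‖ ^ 2 ≤
      (1 - α * μ + 4 * L ^ 2 * α ^ 2) * ‖mean y - xs‖ ^ 2
        + (α / μ + 4 * α ^ 2) * (L ^ 2 * disagreement y) := by
  have hN : (0 : ℝ) < N := by exact_mod_cast Nat.pos_of_neZero N
  set h : Vec m := mean fun i => gradient (f i) (mean y) - gradient (f i) xs with hh
  set r : Vec m := mean fun i => gradient (f i) (y i) - gradient (f i) (mean y) with hr
  have hmean : mean (fun i => gradient (f i) (y i) + 0) = h + r := by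
    rw [hh, hr, ← mean_add]
    simp only [mean, Finset.sum_add_distrib, Finset.sum_sub_distrib, hxs]
    congr 1
    simp
  have hmono : μ * ‖mean y - xs‖ ^ 2 ≤ ⟪mean y - xs, h⟫ := by
    have hh' : h = (Fintype.card (Fin N) : ℝ)⁻¹ • ∑ i,
        (gradient (f i) (mean y) - gradient (f i) xs) := rfl
    rw [hh', real_inner_smul_right, inner_sum, Fintype.card_fin, le_inv_mul_iff₀ hN]
    calc (N : ℝ) * (μ * ‖mean y - xs‖ ^ 2) = ∑ _i : Fin N, μ * ‖mean y - xs‖ ^ 2 := by simp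
      _ ≤ _ := Finset.sum_le_sum fun i _ => hf.le_inner_gradient_sub i _ _
  have hLip : ‖h‖ ≤ L * ‖mean y - xs‖ := by
    rw [hh, mean, norm_smul, norm_inv, Fintype.card_fin, Real.norm_natCast, inv_mul_le_iff₀ hN]
    calc _ ≤ ∑ _i : Fin N, L * ‖mean y - xs‖ :=
          norm_sum_le_of_le _ fun i _ => hf.norm_gradient_sub_le i _ _
      _ = _ := by simp
  have hr2 : ‖r‖ ^ 2 ≤ L ^ 2 * disagreement y := by
    refine (norm_mean_sq_le _).trans ?_
    rw [disagreement, Finset.mul_sum]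
    refine Finset.sum_le_sum fun i _ => ?_
    rw [← mul_pow]
    gcongr
    exact hf.norm_gradient_sub_le i _ _
  have key := norm_sq_step_le (d := mean y - xs) (ℓ := 0) (h := h) (w := r) (ρ := 0) (L := L)
    zero_lt_one hα (by simp) (by simp) hmono
    (by rw [← mul_pow]; gcongr)
  rw [mean_step ha, hmean]
  have e : mean y - α • (h + r) - xs = mean y - xs - 0 - α • (h + r) := by abel
  rw [e]
  have h1 := mul_le_mul_of_nonneg_left (two_mul_inner_le (mean y - xs) r hf.mu_pos) hα
  have h2 : (α / μ + 4 * α ^ 2) * ‖r‖ ^ 2 ≤ (α / μ + 4 * α ^ 2) * (L ^ 2 * disagreement y) := by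
    have := hf.mu_pos
    gcongr
  have h3 : α / μ * ‖r‖ ^ 2 = α * (1 / μ * ‖r‖ ^ 2) := by ring
  have h4 : (2 : ℝ) * (1 + 1 / (1 - 0)) = 4 := by norm_num
  rw [h4] at key
  linarith

end Pathwise

/-! ### Rates for the noiseless iterates and for the effect of the noise -/

section Rates

variable {Ω : Type*} {mΩ : MeasurableSpace Ω} {P : Measure Ω} [IsProbabilityMeasure P]
  {N m : ℕ} {f : Fin N → Vec m → ℝ} {μ L : ℝ} {G : ℕ → Ω → SimpleGraph (Fin N)}
  {v : Fin N → ℕ → Ω → Vec m} {α₀ β₀ ν ρ : ℝ} {x₀ : Fin N → Vec m}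

/-- The iterates of the method run without noise on the same graphs. -/
abbrev noiseless (f : Fin N → Vec m → ℝ) (G : ℕ → Ω → SimpleGraph (Fin N)) (α β : ℕ → ℝ)
    (x₀ : Fin N → Vec m) : ℕ → Ω → Fin N → Vec m :=
  iterate f G (fun _ _ _ => 0) α β x₀

lemma memLp_noiseless (hf : CostAssumption f μ L) (hG : NetworkAssumption P G) {α β : ℕ → ℝ}
    (k : ℕ) (i : Fin N) : MemLp (fun ω => noiseless f G α β x₀ k ω i) 2 P :=
  memLp_iterate hf hG.measurable (fun _ _ => MemLp.zero) k i

lemma eventually_noiseless_bounded (hf : CostAssumption f μ L) (hG : NetworkAssumption P G)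
    (hα : 0 < α₀) {β : ℕ → ℝ} (hρ : ρ < 1)
    (hst : ∀ᶠ k in atTop, ∀ᵐ ω ∂P, StableWeights (adjWeight (G k ω)) (β k) ρ) (xs : Vec m) :
    ∃ M, 0 ≤ M ∧ ∀ᶠ k in atTop,
      ∫ ω, ∑ i, ‖noiseless f G (stepAlpha α₀) β x₀ k ω i - xs‖ ^ 2 ∂P ≤ M := by
  have hρ' : 0 < 1 - ρ := by linarith
  have hμ := hf.mu_pos
  set S := ∑ i, ‖gradient (f i) xs‖ ^ 2
  have hS : 0 ≤ S := Finset.sum_nonneg fun _ _ => sq_nonneg _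
  have hint : ∀ k, Integrable
      (fun ω => ∑ i, ‖noiseless f G (stepAlpha α₀) β x₀ k ω i - xs‖ ^ 2) P := fun k =>
    integrable_sum_norm_sq fun i => (memLp_noiseless hf hG k i).sub (memLp_const xs)
  refine eventually_bounded_of_stepAlpha (C := 2 * (1 + 1 / (1 - ρ)) * L ^ 2)
    (W := (1 / μ + 2 * (1 + 1 / (1 - ρ)) * α₀) * S) hα hμ
    (fun k => integral_nonneg fun ω => Finset.sum_nonneg fun _ _ => sq_nonneg _) ?_
  filter_upwards [hst] with k hk
  have hα' := stepAlpha_pos hα k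
  have h1 : ∫ ω, ∑ i, ‖noiseless f G (stepAlpha α₀) β x₀ (k + 1) ω i - xs‖ ^ 2 ∂P ≤
      ∫ ω, ((1 - stepAlpha α₀ k * μ + 2 * (1 + 1 / (1 - ρ)) * L ^ 2 * stepAlpha α₀ k ^ 2)
        * ∑ i, ‖noiseless f G (stepAlpha α₀) β x₀ k ω i - xs‖ ^ 2
        + (stepAlpha α₀ k / μ + 2 * (1 + 1 / (1 - ρ)) * stepAlpha α₀ k ^ 2) * S) ∂P := by
    refine integral_mono_ae (hint _) (((hint k).const_mul _).add (integrable_const _)) ?_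
    filter_upwards [hk] with ω hω
    simp only [noiseless, iterate_succ]
    exact hf.sum_norm_sq_step_sub_solution_le hω hρ hα'.le _ xs
  rw [integral_add ((hint k).const_mul _) (integrable_const _), integral_const_mul] at h1
  refine h1.trans ?_
  have h2 : (stepAlpha α₀ k / μ + 2 * (1 + 1 / (1 - ρ)) * stepAlpha α₀ k ^ 2) * S ≤
      (1 / μ + 2 * (1 + 1 / (1 - ρ)) * α₀) * S * stepAlpha α₀ k := by
    calc _ = (1 / μ + 2 * (1 + 1 / (1 - ρ)) * stepAlpha α₀ k) * S * stepAlpha α₀ k := by ring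
      _ ≤ _ := by gcongr; exact stepAlpha_le hα k
  simp only [integral_const, probReal_univ, one_smul]
  linarith

/-- The mean squared disagreement of the noiseless iterates is `O(1 / k)`: contraction at the
rate `β_k ≳ k ^ (-1/2)` against perturbations of size `α_k`. -/
lemma eventually_disagreement_le [NeZero N] (hf : CostAssumption f μ L)
    (hG : NetworkAssumption P G) (hα : 0 < α₀) (hβ : 0 < β₀) (hν0 : 0 ≤ ν) (hν : ν ≤ 1 / 2)
    (hρ : ρ < 1)
    (hst : ∀ᶠ k in atTop, ∀ᵐ ω ∂P,
      StableWeights (adjWeight (G k ω)) (stepBeta β₀ ν k) ρ) :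
    ∃ M, 0 ≤ M ∧ ∀ᶠ k : ℕ in atTop,
      ∫ ω, disagreement (noiseless f G (stepAlpha α₀) (stepBeta β₀ ν) x₀ k ω) ∂P
        ≤ M / ((k : ℝ) + 1) := by
  have hρ' : 0 < 1 - ρ := by linarith
  obtain ⟨M, hM0, hM⟩ := eventually_noiseless_bounded (x₀ := x₀) hf hG hα hρ hst 0
  obtain ⟨c, hc, hce⟩ := exists_mul_integral_disagreement_le (α := stepAlpha α₀)
    (β := stepBeta β₀ ν) (x₀ := x₀) hf hG
  set y := noiseless f G (stepAlpha α₀) (stepBeta β₀ ν) x₀ with hy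
  have hyL : ∀ k i, MemLp (fun ω => y k ω i) 2 P := fun k i => memLp_noiseless hf hG k i
  -- the summand `0`, here and below, is the vanishing noise in the recursion of `iterate`
  have hgL : ∀ k i, MemLp (fun ω => gradient (f i) (y k ω i) + 0) 2 P := fun k i => by
    simpa using hf.memLp_gradient i (hyL k i)
  -- the mean squared gradients along the noiseless iterates are bounded
  set W := 2 * ∑ i, ‖gradient (f i) 0‖ ^ 2 + 2 * L ^ 2 * M with hW
  have hW0 : 0 ≤ W := by
    have : 0 ≤ ∑ i, ‖gradient (f i) 0‖ ^ 2 := Finset.sum_nonneg fun _ _ => sq_nonneg _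
    positivity
  have hgrad : ∀ᶠ k in atTop, ∫ ω, ∑ i, ‖gradient (f i) (y k ω i) + 0‖ ^ 2 ∂P ≤ W := by
    filter_upwards [hM] with k hk
    simp only [sub_zero] at hk
    have h1 : ∀ ω, ∑ i, ‖gradient (f i) (y k ω i) + 0‖ ^ 2 ≤
        2 * ∑ i, ‖gradient (f i) 0‖ ^ 2 + 2 * L ^ 2 * ∑ i, ‖y k ω i‖ ^ 2 := fun ω => by
      rw [Finset.mul_sum, Finset.mul_sum, ← Finset.sum_add_distrib]
      refine Finset.sum_le_sum fun i _ => ?_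
      have h2 := norm_add_sq_le_two_mul (gradient (f i) 0)
        (gradient (f i) (y k ω i) - gradient (f i) 0)
      rw [add_sub_cancel] at h2
      have h3 : ‖gradient (f i) (y k ω i) - gradient (f i) 0‖ ^ 2 ≤ L ^ 2 * ‖y k ω i‖ ^ 2 := by
        rw [← mul_pow]
        gcongr
        simpa using hf.norm_gradient_sub_le i (y k ω i) 0
      rw [add_zero]
      linarith
    have hint := integrable_sum_norm_sq (hyL k)
    have hint' : Integrable (fun ω => 2 * ∑ i, ‖gradient (f i) 0‖ ^ 2
        + 2 * L ^ 2 * ∑ i, ‖y k ω i‖ ^ 2) P := (integrable_const _).add (hint.const_mul _)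
    refine (integral_mono (integrable_sum_norm_sq (hgL k)) hint' h1).trans ?_
    rw [integral_add (integrable_const _) (hint.const_mul _), integral_const_mul (2 * L ^ 2)]
    simp only [integral_const, probReal_univ, one_smul, hW]
    gcongr
  -- the diffusion contracts by the factor `1 - t β_k`; the minimum with `1 / β₀` in `t` keeps
  -- `t β_k` at most `1`
  set t := min ((1 - ρ) * c) (1 / β₀) with ht
  have ht0 : 0 < t := lt_min (by positivity) (by positivity)
  have hβp : ∀ k, 0 < stepBeta β₀ ν k := stepBeta_pos hβ ν
  have hτ1 : ∀ k, t * stepBeta β₀ ν k ≤ 1 := fun k => by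
    calc t * stepBeta β₀ ν k ≤ 1 / β₀ * β₀ :=
          mul_le_mul (min_le_right _ _) (stepBeta_le hβ hν0 k) (hβp k).le (by positivity)
      _ = 1 := by field_simp
  have hτ2 : ∀ k : ℕ, t ^ 2 * β₀ ^ 2 ≤ (t * stepBeta β₀ ν k) ^ 2 * ((k : ℝ) + 1) := fun k => by
    have := sq_div_le_stepBeta_sq (β₀ := β₀) hν k
    rw [div_le_iff₀ (by positivity)] at this
    calc t ^ 2 * β₀ ^ 2 ≤ t ^ 2 * (stepBeta β₀ ν k ^ 2 * ((k : ℝ) + 1)) := by gcongr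
      _ = _ := by ring
  refine eventually_le_div_of_recursion (γ := fun k => t * stepBeta β₀ ν k / 2) (r := 2)
    (B := 6 * α₀ ^ 2 / (t ^ 2 * β₀ ^ 2) * W) one_lt_two
    (Eventually.of_forall fun k => by linarith [hτ1 k]) ?_ ?_
  · have h1 : Tendsto (fun k : ℕ => (k : ℝ) + 1) atTop atTop :=
      tendsto_atTop_add_const_right _ _ tendsto_natCast_atTop_atTop
    filter_upwards [h1.eventually_ge_atTop (16 / (t ^ 2 * β₀ ^ 2))] with k hk
    rw [div_le_iff₀ (by positivity)] at hk
    have hk1 : (0 : ℝ) < (k : ℝ) + 1 := by positivity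
    have h2 := mul_le_mul_of_nonneg_left (hτ2 k) hk1.le
    have := hβp k
    refine le_of_sq_le_sq ?_ (by positivity)
    nlinarith
  · filter_upwards [hst, hgrad] with k hk hg
    have hα' := stepAlpha_pos hα k
    set τ := t * stepBeta β₀ ν k with hτ
    have hτ0 : 0 < τ := mul_pos ht0 (hβp k)
    have hen : Integrable (fun ω => energy (adjWeight (G k ω)) (y k ω)) P := by
      refine integrable_finsetSum _ fun i _ => integrable_finsetSum _ fun j _ => ?_
      refine (integrable_norm_sq ((hyL k i).sub (hyL k j))).bdd_mul (c := 1)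
        (measurable_adjWeight (hG.measurable k) i j).aestronglyMeasurable
        (Eventually.of_forall fun ω => ?_)
      rw [Real.norm_of_nonneg (adjWeight_nonneg _ _ _)]
      exact adjWeight_le_one _ _ _
    have hdis := integrable_disagreement (hyL k)
    have hgi := integrable_sum_norm_sq (hgL k)
    have hsub : Integrable (fun ω => disagreement (y k ω)
        - (1 - ρ) * stepBeta β₀ ν k * energy (adjWeight (G k ω)) (y k ω)) P :=
      hdis.sub (hen.const_mul _)
    have h1 : ∫ ω, disagreement (y (k + 1) ω) ∂P ≤
        ∫ ω, ((1 + τ / 2) * (disagreement (y k ω)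
            - (1 - ρ) * stepBeta β₀ ν k * energy (adjWeight (G k ω)) (y k ω))
          + (1 + 1 / (τ / 2)) * stepAlpha α₀ k ^ 2
            * ∑ i, ‖gradient (f i) (y k ω i) + 0‖ ^ 2) ∂P := by
      refine integral_mono_ae (integrable_disagreement (hyL (k + 1)))
        ((hsub.const_mul _).add (hgi.const_mul _)) ?_
      filter_upwards [hk] with ω hω
      have e : y (k + 1) ω = fun i => y k ω i
          - stepBeta β₀ ν k • diffusion (adjWeight (G k ω)) (y k ω) i
          - stepAlpha α₀ k • (gradient (f i) (y k ω i) + 0) := funext fun i => iterate_succ k ω i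
      simp only [e]
      exact hω.disagreement_step_le (half_pos hτ0) _ _
    rw [integral_add (hsub.const_mul _) (hgi.const_mul _),
      integral_const_mul, integral_const_mul, integral_sub hdis (hen.const_mul _),
      integral_const_mul] at h1
    set b := ∫ ω, disagreement (y k ω) ∂P with hb
    have hb0 : 0 ≤ b := integral_nonneg fun ω => disagreement_nonneg _
    have h2 : τ * b ≤ (1 - ρ) * stepBeta β₀ ν k
        * ∫ ω, energy (adjWeight (G k ω)) (y k ω) ∂P := by
      calc τ * b ≤ (1 - ρ) * c * stepBeta β₀ ν k * b := by
            have := (hβp k).le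
            rw [hτ]; gcongr; exact min_le_left _ _
        _ = (1 - ρ) * stepBeta β₀ ν k * (c * b) := by ring
        _ ≤ _ := mul_le_mul_of_nonneg_left (hce k) (mul_nonneg hρ'.le (hβp k).le)
    have h3 : (1 + τ / 2) * (b - (1 - ρ) * stepBeta β₀ ν k
        * ∫ ω, energy (adjWeight (G k ω)) (y k ω) ∂P) ≤ (1 - τ / 2) * b := by
      calc _ ≤ (1 + τ / 2) * (b - τ * b) := by gcongr
        _ ≤ _ := by nlinarith [mul_nonneg (sq_nonneg τ) hb0]
    -- `α_k² / τ = O(τ / (k + 1))` since `τ²` is at least a multiple of `1 / (k + 1)`: `ν ≤ 1/2`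
    have h4 : (1 + 1 / (τ / 2)) * stepAlpha α₀ k ^ 2
        * ∫ ω, ∑ i, ‖gradient (f i) (y k ω i) + 0‖ ^ 2 ∂P ≤
        6 * α₀ ^ 2 / (t ^ 2 * β₀ ^ 2) * W * (τ / 2) / ((k : ℝ) + 1) := by
      have h5 : 1 + 1 / (τ / 2) ≤ 3 / τ := by
        have : 1 ≤ 1 / τ := by rw [le_div_iff₀ hτ0]; linarith [hτ1 k]
        have e1 : 1 / (τ / 2) = 2 * (1 / τ) := by field_simp
        have e2 : 3 / τ = 3 * (1 / τ) := by ring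
        linarith
      have h6 : stepAlpha α₀ k ^ 2 ≤ α₀ ^ 2 / (t ^ 2 * β₀ ^ 2) * τ ^ 2 / ((k : ℝ) + 1) := by
        have hk1 : (0 : ℝ) < (k : ℝ) + 1 := by positivity
        have e1 : stepAlpha α₀ k ^ 2 = α₀ ^ 2 / ((k : ℝ) + 1) ^ 2 := by
          unfold stepAlpha; rw [div_pow]
        have e2 : α₀ ^ 2 / (t ^ 2 * β₀ ^ 2) * τ ^ 2 / ((k : ℝ) + 1) =
            α₀ ^ 2 / ((k : ℝ) + 1) ^ 2 * (τ ^ 2 * ((k : ℝ) + 1) / (t ^ 2 * β₀ ^ 2)) := by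
          field_simp
        rw [e1, e2]
        refine le_mul_of_one_le_right (by positivity) ?_
        rw [one_le_div (by positivity)]
        exact hτ2 k
      calc _ ≤ 3 / τ * (α₀ ^ 2 / (t ^ 2 * β₀ ^ 2) * τ ^ 2 / ((k : ℝ) + 1)) * W := by
            gcongr
        _ = _ := by field_simp; ring
    exact h1.trans (add_le_add h3 h4)

lemma eventually_noiseless_mean_le [NeZero N] (hf : CostAssumption f μ L)
    (hG : NetworkAssumption P G) (hα : 0 < α₀) (hαμ : 2 < α₀ * μ) {β : ℕ → ℝ}
    {xs : Vec m} (hxs : ∑ i, gradient (f i) xs = 0) {M : ℝ}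
    (hM : ∀ᶠ k : ℕ in atTop,
      ∫ ω, disagreement (noiseless f G (stepAlpha α₀) β x₀ k ω) ∂P ≤ M / ((k : ℝ) + 1)) :
    ∃ M', 0 ≤ M' ∧ ∀ᶠ k : ℕ in atTop,
      ∫ ω, ‖mean (noiseless f G (stepAlpha α₀) β x₀ k ω) - xs‖ ^ 2 ∂P ≤ M' / ((k : ℝ) + 1) := by
  have hμ := hf.mu_pos
  set y := noiseless f G (stepAlpha α₀) β x₀ with hy
  have hyL : ∀ k i, MemLp (fun ω => y k ω i) 2 P := fun k i => memLp_noiseless hf hG k i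
  have hint : ∀ k, Integrable (fun ω => ‖mean (y k ω) - xs‖ ^ 2) P := fun k =>
    integrable_norm_sq ((memLp_mean (hyL k)).sub (memLp_const xs))
  refine eventually_le_div_of_stepAlpha (C := 4 * L ^ 2)
    (W := (1 / μ + 4 * α₀) * (L ^ 2 * M)) hα hμ hαμ
    (fun k => integral_nonneg fun ω => sq_nonneg _) ?_
  filter_upwards [hM] with k hk
  have hα' := stepAlpha_pos hα k
  have hdis := integrable_disagreement (hyL k)
  have h1 : ∫ ω, ‖mean (y (k + 1) ω) - xs‖ ^ 2 ∂P ≤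
      ∫ ω, ((1 - stepAlpha α₀ k * μ + 4 * L ^ 2 * stepAlpha α₀ k ^ 2) * ‖mean (y k ω) - xs‖ ^ 2
        + (stepAlpha α₀ k / μ + 4 * stepAlpha α₀ k ^ 2) * (L ^ 2 * disagreement (y k ω))) ∂P := by
    refine integral_mono (hint _) (((hint k).const_mul _).add
      ((hdis.const_mul _).const_mul _)) fun ω => ?_
    have e : y (k + 1) ω = fun i => y k ω i - β k • diffusion (adjWeight (G k ω)) (y k ω) i
        - stepAlpha α₀ k • (gradient (f i) (y k ω i) + 0) := funext fun i => iterate_succ k ω i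
    simp only [e]
    exact hf.norm_sq_mean_step_sub_le (adjWeight_comm _) hα'.le _ hxs _
  rw [integral_add ((hint k).const_mul _) ((hdis.const_mul _).const_mul _), integral_const_mul,
    integral_const_mul, integral_const_mul] at h1
  refine h1.trans (add_le_add le_rfl ?_)
  have hd0 : 0 ≤ ∫ ω, disagreement (y k ω) ∂P := integral_nonneg fun ω => disagreement_nonneg _
  calc _ = (1 / μ + 4 * stepAlpha α₀ k) * stepAlpha α₀ k
          * (L ^ 2 * ∫ ω, disagreement (y k ω) ∂P) := by ring
    _ ≤ (1 / μ + 4 * α₀) * stepAlpha α₀ k * (L ^ 2 * (M / ((k : ℝ) + 1))) := by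
        gcongr
        exact stepAlpha_le hα k
    _ = _ := by ring

/-- The effect of the noise. The difference to the noiseless iterates is known to the history,
hence orthogonal to the current noise, while the correlation of the noise with the current graph
is absorbed by the dissipation of the diffusion. -/
lemma eventually_noise_effect_le (hf : CostAssumption f μ L)
    (hG : NetworkAssumption P G) (hα : 0 < α₀) (hαμ : 2 < α₀ * μ) {β : ℕ → ℝ} (hρ : ρ < 1)
    (hst : ∀ᶠ k in atTop, ∀ᵐ ω ∂P, StableWeights (adjWeight (G k ω)) (β k) ρ) {c c' : ℝ}
    (hv : NoiseAssumption P G v (iterate f G v (stepAlpha α₀) β x₀) c c') :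
    ∃ M, 0 ≤ M ∧ ∀ᶠ k : ℕ in atTop,
      ∫ ω, ∑ i, ‖iterate f G v (stepAlpha α₀) β x₀ k ω i
        - noiseless f G (stepAlpha α₀) β x₀ k ω i‖ ^ 2 ∂P ≤ M / ((k : ℝ) + 1) := by
  have hρ' : 0 < 1 - ρ := by linarith
  have hμ := hf.mu_pos
  obtain ⟨M, hM0, hM⟩ := eventually_noiseless_bounded (x₀ := x₀) hf hG hα hρ hst 0
  set x := iterate f G v (stepAlpha α₀) β x₀ with hx
  set y := noiseless f G (stepAlpha α₀) β x₀ with hy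
  have hyL : ∀ k i, MemLp (fun ω => y k ω i) 2 P := fun k i => memLp_noiseless hf hG k i
  have hxL : ∀ k i, MemLp (fun ω => x k ω i) 2 P := fun k i =>
    memLp_iterate hf hG.measurable hv.memLp k i
  have hdL : ∀ k i, MemLp (fun ω => x k ω i - y k ω i) 2 P := fun k i => (hxL k i).sub (hyL k i)
  have hint := fun k => integrable_sum_norm_sq (hdL k)
  set κ := 1 + 1 / (1 - ρ) with hκ
  have hκ0 : 0 < κ := by positivity
  refine eventually_le_div_of_stepAlpha (C := 2 * κ * L ^ 2 + 4 * κ * c)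
    (W := 2 * κ * (2 * c * M + N * c') * α₀) hα hμ hαμ
    (fun k => integral_nonneg fun ω => Finset.sum_nonneg fun _ _ => sq_nonneg _) ?_
  filter_upwards [hst, hM] with k hk hMk
  simp only [sub_zero] at hMk
  have hα' := stepAlpha_pos hα k
  have hvi := integrable_sum_norm_sq (X := fun ω i => v i k ω) fun i => hv.memLp i k
  have hii : ∀ i, Integrable (fun ω => ⟪x k ω i - y k ω i, v i k ω⟫) P := fun i =>
    integrable_inner_of_memLp (hdL k i) (hv.memLp i k)
  have hsi := integrable_finsetSum Finset.univ fun i _ => hii i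
  have horth : ∫ ω, ∑ i, ⟪x k ω i - y k ω i, v i k ω⟫ ∂P = 0 := by
    rw [integral_finsetSum _ fun i _ => hii i]
    refine Finset.sum_eq_zero fun i _ => ?_
    have hxm : Measurable[history G v k] fun ω => x k ω i :=
      @measurable_iterate Ω N m f μ L G v (stepAlpha α₀) β x₀ (history G v k) hf k
        (fun s hs => measurable_laplacian_history hs)
        (fun i s hs => measurable_noise_history hs i) i
    have hym : Measurable[history G v k] fun ω => y k ω i :=
      @measurable_iterate Ω N m f μ L G _ (stepAlpha α₀) β x₀ (history G v k) hf k
        (fun s hs => measurable_laplacian_history hs) (fun _ _ _ => measurable_const) i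
    exact integral_inner_eq_zero_of_condExp (history_le hG.measurable hv.measurable k)
      (hxm.stronglyMeasurable.sub hym.stronglyMeasurable) (hdL k i) (hv.memLp i k)
      (hv.condMean i k)
  have hsub : Integrable (fun ω =>
      (1 - 2 * (stepAlpha α₀ k * μ) + 2 * κ * L ^ 2 * stepAlpha α₀ k ^ 2)
          * ∑ i, ‖x k ω i - y k ω i‖ ^ 2
        - 2 * stepAlpha α₀ k * ∑ i, ⟪x k ω i - y k ω i, v i k ω⟫) P :=
    ((hint k).const_mul _).sub (hsi.const_mul _)
  have h1 : ∫ ω, ∑ i, ‖x (k + 1) ω i - y (k + 1) ω i‖ ^ 2 ∂P ≤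
      ∫ ω, ((1 - 2 * (stepAlpha α₀ k * μ) + 2 * κ * L ^ 2 * stepAlpha α₀ k ^ 2)
          * ∑ i, ‖x k ω i - y k ω i‖ ^ 2
        - 2 * stepAlpha α₀ k * ∑ i, ⟪x k ω i - y k ω i, v i k ω⟫
        + 2 * κ * stepAlpha α₀ k ^ 2 * ∑ i, ‖v i k ω‖ ^ 2) ∂P := by
    refine integral_mono_ae (hint (k + 1)) (hsub.add (hvi.const_mul _)) ?_
    filter_upwards [hk] with ω hω
    have key := hf.sum_norm_sq_step_sub_le hω hρ hα'.le (x k ω) (y k ω) (fun i => v i k ω)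
      (fun _ => 0)
    simp only [hx, hy, noiseless, iterate_succ]
    simpa only [sub_zero] using key
  rw [integral_add hsub (hvi.const_mul _),
    integral_sub ((hint k).const_mul _) (hsi.const_mul _), integral_const_mul,
    integral_const_mul, integral_const_mul, horth] at h1
  set A := ∫ ω, ∑ i, ‖x k ω i - y k ω i‖ ^ 2 ∂P with hA
  have hA0 : 0 ≤ A := integral_nonneg fun ω => Finset.sum_nonneg fun _ _ => sq_nonneg _
  have h2 : ∫ ω, ∑ i, ‖x k ω i‖ ^ 2 ∂P ≤ 2 * A + 2 * M := by
    have h3 : ∫ ω, ∑ i, ‖x k ω i‖ ^ 2 ∂P ≤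
        ∫ ω, (2 * ∑ i, ‖x k ω i - y k ω i‖ ^ 2 + 2 * ∑ i, ‖y k ω i‖ ^ 2) ∂P := by
      refine integral_mono (integrable_sum_norm_sq (hxL k)) (((hint k).const_mul _).add
        ((integrable_sum_norm_sq (hyL k)).const_mul _)) fun ω => ?_
      simp only
      rw [Finset.mul_sum, Finset.mul_sum, ← Finset.sum_add_distrib]
      refine Finset.sum_le_sum fun i _ => ?_
      have := norm_add_sq_le_two_mul (x k ω i - y k ω i) (y k ω i)
      rwa [sub_add_cancel] at this
    rw [integral_add ((hint k).const_mul _) ((integrable_sum_norm_sq (hyL k)).const_mul _),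
      integral_const_mul, integral_const_mul] at h3
    linarith
  have h4 : ∫ ω, ∑ i, ‖v i k ω‖ ^ 2 ∂P ≤ 2 * c * A + (2 * c * M + N * c') := by
    have := integral_sum_noise_le hG.measurable hv hxL k
    have := mul_le_mul_of_nonneg_left h2 hv.c_nonneg
    linarith
  have h5 := mul_le_mul_of_nonneg_left h4 (by positivity : 0 ≤ 2 * κ * stepAlpha α₀ k ^ 2)
  have h6 : 2 * κ * (2 * c * M + N * c') * α₀ * (stepAlpha α₀ k / ((k : ℝ) + 1)) =
      2 * κ * (2 * c * M + N * c') * stepAlpha α₀ k ^ 2 := by rw [stepAlpha_sq]; ring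
  have h7 : 0 ≤ stepAlpha α₀ k * μ * A := by positivity
  rw [h6]
  linarith

end Rates

end DistSGD

end

theorem theorem1 {Ω : Type*} [MeasurableSpace Ω] (P : Measure Ω) [IsProbabilityMeasure P]
    (N m : ℕ) (f : Fin N → DistSGD.Vec m → ℝ) (μ L : ℝ)
    (G : ℕ → Ω → SimpleGraph (Fin N)) (v : Fin N → ℕ → Ω → DistSGD.Vec m)
    (x₀ : Fin N → DistSGD.Vec m) (α₀ β₀ ν c c' : ℝ)
    (x : ℕ → Ω → Fin N → DistSGD.Vec m)
    (hx : x = DistSGD.iterate f G v (DistSGD.stepAlpha α₀) (DistSGD.stepBeta β₀ ν) x₀)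
    (hα : 2 * (N : ℝ) / μ < α₀) (hβ : 0 < β₀) (hν : ν ∈ Set.Icc (0 : ℝ) (1 / 2))
    (hβ_small : ν = 0 → ∀ k i, ∀ᵐ ω ∂P, β₀ * ((DistSGD.neighbors (G k ω) i).card : ℝ) < 1)
    (hf : DistSGD.CostAssumption f μ L)
    (hG : DistSGD.NetworkAssumption P G)
    (hv : DistSGD.NoiseAssumption P G v x c c') :
    ∃ xstar : DistSGD.Vec m,
      DistSGD.IsSolution f xstar ∧
      (∀ y, DistSGD.IsSolution f y → y = xstar) ∧
      ∀ i : Fin N,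
        (∀ k, Integrable (fun ω => ‖x k ω i - xstar‖ ^ 2) P) ∧
        (fun k : ℕ => ∫ ω, ‖x k ω i - xstar‖ ^ 2 ∂P) =O[atTop] fun k : ℕ => 1 / (k : ℝ) := by
  subst hx
  have : Nonempty (Fin N) := hG.connected.nonempty
  have : NeZero N := Fin.pos_iff_nonempty.2 this |>.ne' |> NeZero.mk
  have hμ := hf.mu_pos
  have hN : (1 : ℝ) ≤ N := by exact_mod_cast Nat.one_le_iff_ne_zero.2 (NeZero.ne N)
  have hα0 : 0 < α₀ := lt_of_le_of_lt (by positivity) hα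
  have hαμ : 2 < α₀ * μ := by
    rw [div_lt_iff₀ hμ] at hα
    linarith
  obtain ⟨xs, hsol, huniq, hgrad⟩ := hf.exists_unique_solution
  obtain ⟨ρ, hρ, hst⟩ := DistSGD.exists_eventually_stableWeights hβ hν.1 hβ_small
  obtain ⟨M₁, hM₁0, hM₁⟩ := DistSGD.eventually_disagreement_le (x₀ := x₀) hf hG hα0 hβ hν.1 hν.2
    hρ hst
  obtain ⟨M₂, hM₂0, hM₂⟩ := DistSGD.eventually_noiseless_mean_le hf hG hα0 hαμ hgrad hM₁
  obtain ⟨M₃, hM₃0, hM₃⟩ := DistSGD.eventually_noise_effect_le hf hG hα0 hαμ hρ hst hv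
  set x := DistSGD.iterate f G v (DistSGD.stepAlpha α₀) (DistSGD.stepBeta β₀ ν) x₀
  set y := DistSGD.noiseless f G (DistSGD.stepAlpha α₀) (DistSGD.stepBeta β₀ ν) x₀
  have hyL : ∀ k i, MemLp (fun ω => y k ω i) 2 P := fun k i => DistSGD.memLp_noiseless hf hG k i
  have hxL : ∀ k i, MemLp (fun ω => x k ω i) 2 P := fun k i =>
    DistSGD.memLp_iterate hf hG.measurable hv.memLp k i
  have hint : ∀ k i, Integrable (fun ω => ‖x k ω i - xs‖ ^ 2) P := fun k i =>
    DistSGD.integrable_norm_sq ((hxL k i).sub (memLp_const xs))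
  refine ⟨xs, hsol, huniq, fun i => ⟨fun k => hint k i, ?_⟩⟩
  refine IsBigO.of_bound (2 * M₃ + 2 * (M₁ + N * M₂)) ?_
  filter_upwards [hM₁, hM₂, hM₃, eventually_gt_atTop 0] with k h1 h2 h3 hk
  have hk' : (0 : ℝ) < k := by exact_mod_cast hk
  have hd : Integrable (fun ω => ∑ j, ‖x k ω j - y k ω j‖ ^ 2) P :=
    DistSGD.integrable_sum_norm_sq fun j => (hxL k j).sub (hyL k j)
  have hdis := DistSGD.integrable_disagreement (hyL k)
  have hmean : Integrable (fun ω => ‖DistSGD.mean (y k ω) - xs‖ ^ 2) P :=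
    DistSGD.integrable_norm_sq ((DistSGD.memLp_mean (hyL k)).sub (memLp_const xs))
  have hadd : Integrable (fun ω => DistSGD.disagreement (y k ω)
      + N * ‖DistSGD.mean (y k ω) - xs‖ ^ 2) P := hdis.add (hmean.const_mul _)
  have h4 : ∫ ω, ‖x k ω i - xs‖ ^ 2 ∂P ≤ ∫ ω, (2 * ∑ j, ‖x k ω j - y k ω j‖ ^ 2
      + 2 * (DistSGD.disagreement (y k ω) + N * ‖DistSGD.mean (y k ω) - xs‖ ^ 2)) ∂P := by
    refine integral_mono (hint k i) ((hd.const_mul _).add (hadd.const_mul _)) fun ω => ?_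
    have e := DistSGD.sum_norm_sub_sq (y k ω) xs
    rw [Fintype.card_fin] at e
    have h5 := DistSGD.norm_add_sq_le_two_mul (x k ω i - y k ω i) (y k ω i - xs)
    rw [sub_add_sub_cancel] at h5
    have h6 := Finset.single_le_sum (f := fun j => ‖x k ω j - y k ω j‖ ^ 2)
      (fun j _ => sq_nonneg _) (Finset.mem_univ i)
    have h7 := Finset.single_le_sum (f := fun j => ‖y k ω j - xs‖ ^ 2)
      (fun j _ => sq_nonneg _) (Finset.mem_univ i)
    simp only at h6 h7 ⊢
    rw [← e]
    linarith
  rw [integral_add (hd.const_mul _) (hadd.const_mul _),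
    integral_const_mul, integral_const_mul, integral_add hdis (hmean.const_mul _),
    integral_const_mul] at h4
  rw [Real.norm_of_nonneg (integral_nonneg fun ω => sq_nonneg _),
    Real.norm_of_nonneg (by positivity)]
  calc ∫ ω, ‖x k ω i - xs‖ ^ 2 ∂P
      ≤ 2 * (M₃ / ((k : ℝ) + 1)) + 2 * (M₁ / ((k : ℝ) + 1) + N * (M₂ / ((k : ℝ) + 1))) := by
        refine h4.trans ?_
        gcongr
    _ = (2 * M₃ + 2 * (M₁ + N * M₂)) * (1 / ((k : ℝ) + 1)) := by ring
    _ ≤ (2 * M₃ + 2 * (M₁ + N * M₂)) * (1 / (k : ℝ)) := by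
        gcongr
        linarith
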